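/- **Estimating the distance between two symmetric matrices with respect to a parameter $T$.** For real $n\times n$ matrices $A,B$ let $D_M(A,B)=|\{(i,j)\in[n]^2 : A(i,j)\neq B(i,j)\}|$. An inner product (IP) query to a matrix $M\in\{A,B\}$ consists of a row (or column) index $i\in[n]$ and a vector $v\in\{0,1\}^n$, and its answer is the inner product of the $i$-th row (or column) of $M$ with $v$. A randomized algorithm with IP query access to $A$ and $B$ chooses its queries adaptively and outputs a real number; it is modelled as a probability distribution over deterministic adaptive query algorithms (decision trees). For every constant $c\in\mathbb{N}$ there are constants $C_1,C_2>0$ and $k_1,k_2\in\mathbb{N}$, and a randomized algorithm Dist-Symm-Matrix-Guess with inputs $n$, $\varepsilon$, $T$ and IP query access to two unknown $n\times n$ real matrices, such that the following holds for every $n$, every $\varepsilon\in(0,1/2)$, every real $T\ge C_1\left(\frac{1+\log n}{\varepsilon}\right)^{k_1}$ and all symmetric real $n\times n$ matrices $A,B$ (for $n=0$ read $\log n$ as $0$, and the success probability as at least $0$ if $c=0$ and as $1$ if $c\ge1$). 1. In every execution on $A,B$ (whatever the random choices) the algorithm makes at most $C_2\left(\frac{1+\log n}{\varepsilon}\right)^{k_2}\cdot\frac{n}{\sqrt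 T}$ IP queries; that is, it makes $\tilde{O}(n/\sqrt T)$ queries, where $\tilde O$ hides a factor polynomial in $\log n$ and $1/\varepsilon$. 2. With probability at least $1-n^{-c}$ its output $\hat d$ satisfies $$\left(1-\frac{\varepsilon}{10}\right)D_M(A,B)-\frac{\varepsilon}{1600}T\;\le\;\hat d\;\le\;\left(1+\frac{\varepsilon}{10}\right)D_M(A,B).$$ -/

import Mathlib

/-- The matrix distance `D_M(A, B)`: the number of entries in which `A` and `B` differ. -/
noncomputable def matrixDist {n : ℕ} (A B : Matrix (Fin n) (Fin n) ℝ) : ℕ :=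
  (Finset.univ.filter fun p : Fin n × Fin n => A p.1 p.2 ≠ B p.1 p.2).card

/-- Which of the two unknown matrices is queried. -/
inductive MatrixName : Type
  | matA
  | matB

/-- Whether the index of a query names a row or a column. -/
inductive LineKind : Type
  | row
  | column

/-- An inner product (IP) query: the name of a matrix, a row or column index of it, and a
vector in `{0,1}^n`. -/
structure IPQuery (n : ℕ) : Type where
  matrix : MatrixName
  kind : LineKind
  index : Fin n
  vector : Fin n → Bool

/-- The row or the column of `M` with the given index. -/
def matrixLine {n : ℕ} (M : Matrix (Fin n) (Fin n) ℝ) (kind : LineKind) (i : Fin n) :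
    Fin n → ℝ :=
  match kind with
  | .row => fun j => M i j
  | .column => fun j => M j i

/-- The answer of the IP oracle: the inner product of the named row or column with the
`{0,1}`-vector of the query. -/
def IPQuery.answer {n : ℕ} (A B : Matrix (Fin n) (Fin n) ℝ) (q : IPQuery n) : ℝ :=
  let M := match q.matrix with
    | .matA => A
    | .matB => B
  ∑ j : Fin n, matrixLine M q.kind q.index j * (if q.vector j then 1 else 0)

/-- A deterministic adaptive algorithm with IP access to two `n × n` matrices and a real output
(a decision tree): it either halts with an output, or asks a query and continues in a way that
depends on the answer. -/
inductive IPAlgorithm (n : ℕ) : Type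
  | output (d : ℝ) : IPAlgorithm n
  | ask (q : IPQuery n) (next : ℝ → IPAlgorithm n) : IPAlgorithm n

/-- The output of the algorithm when the unknown matrices are `A` and `B`. -/
def IPAlgorithm.run {n : ℕ} (A B : Matrix (Fin n) (Fin n) ℝ) : IPAlgorithm n → ℝ
  | .output d => d
  | .ask q next => (next (q.answer A B)).run A B

/-- The number of IP queries asked when the unknown matrices are `A` and `B`. -/
def IPAlgorithm.numQueries {n : ℕ} (A B : Matrix (Fin n) (Fin n) ℝ) : IPAlgorithm n → ℕ
  | .output _ => 0
  | .ask q next => (next (q.answer A B)).numQueries A B + 1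

/-- A randomized algorithm with IP access: a probability distribution over deterministic ones
(all random choices are drawn at the start, independently of the unknown matrices). -/
abbrev RandomizedIPAlgorithm (n : ℕ) : Type := PMF (IPAlgorithm n)

/-- The distribution of the output of a randomized algorithm on the matrices `A` and `B`. -/
noncomputable def RandomizedIPAlgorithm.outputLaw {n : ℕ} (R : RandomizedIPAlgorithm n)
    (A B : Matrix (Fin n) (Fin n) ℝ) : MeasureTheory.Measure ℝ :=
  (PMF.map (IPAlgorithm.run A B) R).toMeasure

/-!
The distance `D` of two symmetric matrices `A`, `B` is the number of pairs `(i, j)` with `j ∈ N i`,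
where `N i` is the set of positions at which the `i`-th rows differ; it is the number of edges,
counted with orientation, of a graph with loops. The algorithm estimates this number by sampling
random neighbours of random vertices.

The only use of inner products is to simulate hitting queries "does `N i` meet `S`?". A random
`0/1`-vector supported on `S` tells the two rows apart with probability at least `1/2` if they
differ on `S`, and never otherwise (`unifProb_dot_eq_zero_le`). The queries that are asked when all
answers are correct do not depend on the test vectors, so one set of logarithmically many vectors
serves all queries (`unifProb_run_toIP_ne_le`).

The probability that `2 ^ k` uniformly random indices miss `N i` is `(1 - |N i| / n) ^ (2 ^ k)`.
Estimates of these probabilities for all `k` determine `|N i|` up to a factor `1 + e`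
(`exists_scale_gap`). Their random choices are shared by all rows, so that with high probability
they define once and for all a vector `d` of approximate row sizes
(`unifProb_not_approxSizes_le`), which the algorithm evaluates where it needs it.

A sample takes a uniformly random row `i` and, by binary search in a random order of the indices, a
uniformly random `j ∈ N i`. Its value is `n * d i` times the weight `2`, `1` or `0` according to
whether `d j` is larger than, equal to or smaller than `d i`. The weights of `(i, j)` and `(j, i)`
add up to `2`, so by symmetry the mean is `D` up to a factor `1 ± e`. The weights keep the variance
small: a row has only `O(√D)` elements whose rows are at least as large as itself
(`card_larger_le`), so the second moment is `O(n D ^ (3 / 2))` (`expect_sampleTree_sq_le`). Hence by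
Chebyshev's inequality `O(n / (θ² √T))` samples give an additive error of `θ (D + T)` with constant
probability, and a median of independent averages makes the failure probability exponentially small
(`unifProb_medianOfMeans_ge_le`). Finally the additive error is made one-sided by a shift.
-/

open Finset
open scoped BigOperators

/-! ### Probability on finite sample spaces -/

section FiniteProbability

variable {Ω Ω' : Type*} [Fintype Ω] [Fintype Ω']

open Classical in
/-- The probability of the event `p` under the uniform distribution on `Ω` (zero if `Ω` is
empty). -/
noncomputable def unifProb (p : Ω → Prop) : ℝ := 𝔼 ω, if p ω then (1 : ℝ) else 0

lemma unifProb_nonneg (p : Ω → Prop) : 0 ≤ unifProb p :=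
  expect_nonneg fun ω _ => by split_ifs <;> norm_num

lemma unifProb_mono {p q : Ω → Prop} (h : ∀ ω, p ω → q ω) : unifProb p ≤ unifProb q := by
  refine expect_le_expect fun ω _ => ?_
  by_cases hp : p ω
  · simp [hp, h ω hp]
  · simp only [hp, if_false]; split_ifs <;> norm_num

lemma unifProb_le_one (p : Ω → Prop) : unifProb p ≤ 1 := by
  rcases isEmpty_or_nonempty Ω with h | h
  · simp [unifProb]
  · calc unifProb p ≤ 𝔼 _ω : Ω, (1 : ℝ) :=
          expect_le_expect fun ω _ => by split_ifs <;> norm_num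
      _ = 1 := Fintype.expect_const _

lemma unifProb_not [Nonempty Ω] (p : Ω → Prop) : unifProb (fun ω => ¬ p ω) = 1 - unifProb p := by
  rw [eq_sub_iff_add_eq, unifProb, unifProb, ← expect_add_distrib]
  rw [← Fintype.expect_const (ι := Ω) (1 : ℝ)]
  refine expect_congr rfl fun ω _ => ?_
  by_cases h : p ω <;> simp [h]

open Classical in
lemma unifProb_exists_le {ι : Type*} (s : Finset ι) (p : ι → Ω → Prop) :
    unifProb (fun ω => ∃ i ∈ s, p i ω) ≤ ∑ i ∈ s, unifProb (p i) := by
  unfold unifProb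
  rw [← expect_sum_comm]
  refine expect_le_expect fun ω _ => ?_
  split_ifs with h
  · obtain ⟨i, hi, hp⟩ := h
    calc (1 : ℝ) = if p i ω then 1 else 0 := by simp [hp]
      _ ≤ _ := single_le_sum (f := fun i => if p i ω then (1 : ℝ) else 0)
          (fun j _ => by split_ifs <;> norm_num) hi
  · exact sum_nonneg fun j _ => by split_ifs <;> norm_num

lemma unifProb_exists_le_card {ι : Type*} (s : Finset ι) (p : ι → Ω → Prop) {η : ℝ}
    (h : ∀ i ∈ s, unifProb (p i) ≤ η) :
    unifProb (fun ω => ∃ i ∈ s, p i ω) ≤ s.card * η := by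
  refine (unifProb_exists_le s p).trans ?_
  simpa using sum_le_card_nsmul s _ η h

lemma expect_prod_eq (f : Ω × Ω' → ℝ) : 𝔼 x, f x = 𝔼 a, 𝔼 b, f (a, b) := by
  rw [← univ_product_univ, expect_product]

/-- If the first stage of a two-stage experiment fails with probability at most `η`, and the second
stage fails with probability at most `θ` after every good outcome of the first, then the
experiment fails with probability at most `η + θ`. -/
lemma unifProb_prod_le {p : Ω → Prop} {q : Ω × Ω' → Prop} {η θ : ℝ} (hθ : 0 ≤ θ)
    (hp : unifProb p ≤ η)
    (hq : ∀ a, ¬ p a → unifProb (fun b => q (a, b)) ≤ θ) : unifProb q ≤ η + θ := by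
  classical
  rcases isEmpty_or_nonempty Ω with h | h
  · have : unifProb q = 0 := by simp [unifProb]
    rw [this]
    exact add_nonneg ((unifProb_nonneg p).trans hp) hθ
  calc unifProb q = 𝔼 a, unifProb (fun b => q (a, b)) := expect_prod_eq _
    _ ≤ 𝔼 a, ((if p a then (1 : ℝ) else 0) + θ) := by
        refine expect_le_expect fun a _ => ?_
        by_cases ha : p a
        · simp only [ha, if_true]; linarith [unifProb_le_one fun b => q (a, b)]
        · simpa [ha] using hq a ha
    _ = unifProb p + θ := by rw [expect_add_distrib, Fintype.expect_const]; rfl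
    _ ≤ η + θ := by linarith

lemma unifProb_abs_ge_le (g : Ω → ℝ) {a : ℝ} (ha : 0 < a) :
    unifProb (fun ω => a ≤ |g ω|) ≤ (𝔼 ω, g ω ^ 2) / a ^ 2 := by
  rw [unifProb, expect_div]
  refine expect_le_expect fun ω _ => ?_
  split_ifs with h
  · rw [le_div_iff₀ (by positivity), one_mul, ← sq_abs (g ω)]
    exact pow_le_pow_left₀ ha.le h 2
  · positivity

lemma expect_pi_prod {ι : Type*} [Fintype ι] [DecidableEq ι] (g : ι → Ω → ℝ) :
    𝔼 x : ι → Ω, ∏ i, g i (x i) = ∏ i, 𝔼 ω, g i ω := by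
  simp only [Fintype.expect_eq_sum_div_card, prod_div_distrib, Fintype.prod_sum]
  simp

lemma expect_fin_succ {m : ℕ} (f : (Fin (m + 1) → Ω) → ℝ) :
    𝔼 x, f x = 𝔼 a, 𝔼 y : Fin m → Ω, f (Fin.cons a y) := by
  rw [← expect_prod_eq (fun p : Ω × (Fin m → Ω) => f (Fin.cons p.1 p.2))]
  exact (Fintype.expect_equiv (Fin.consEquiv fun _ => Ω) _ _ fun _ => rfl).symm

/-- Sums of independent centered variables are centered, and their variances add. -/
lemma expect_sum_centered [Nonempty Ω] {g : Ω → ℝ} (hg : 𝔼 ω, g ω = 0) (m : ℕ) :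
    𝔼 x : Fin m → Ω, ∑ k, g (x k) = 0 ∧
      𝔼 x : Fin m → Ω, (∑ k, g (x k)) ^ 2 = m * 𝔼 ω, g ω ^ 2 := by
  induction m with
  | zero => simp
  | succ m ih =>
    obtain ⟨ih1, ih2⟩ := ih
    refine ⟨?_, ?_⟩
    · rw [expect_fin_succ]
      simp only [Fin.sum_univ_succ, Fin.cons_zero, Fin.cons_succ, expect_add_distrib, ih1,
        Fintype.expect_const, hg, add_zero]
    · rw [expect_fin_succ]
      simp only [Fin.sum_univ_succ, Fin.cons_zero, Fin.cons_succ, add_sq, expect_add_distrib, ih2,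
        Fintype.expect_const, ← mul_expect, ih1, mul_zero, add_zero]
      push_cast; ring

/-- Chebyshev's inequality for the average of `m` independent samples. -/
lemma unifProb_average_ge_le [Nonempty Ω] (f : Ω → ℝ) {σ a : ℝ} (hσ : 𝔼 ω, f ω ^ 2 ≤ σ)
    (ha : 0 < a) {m : ℕ} (hm : 16 * σ ≤ m * a ^ 2) (hm0 : 0 < m) :
    unifProb (fun x : Fin m → Ω => a ≤ |(∑ k, f (x k)) / m - 𝔼 ω, f ω|) ≤ 1 / 16 := by
  set μ := 𝔼 ω, f ω with hμ
  have hmR : (0 : ℝ) < m := by exact_mod_cast hm0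
  have hc : 𝔼 ω, (f ω - μ) = 0 := by
    rw [expect_sub_distrib, Fintype.expect_const, hμ, sub_self]
  have hv : 𝔼 ω, (f ω - μ) ^ 2 ≤ σ := by
    have : 𝔼 ω, (f ω - μ) ^ 2 = 𝔼 ω, f ω ^ 2 - μ ^ 2 := by
      have h : ∀ ω, (f ω - μ) ^ 2 = f ω ^ 2 - 2 * μ * f ω + μ ^ 2 := fun ω => by ring
      simp only [h, expect_add_distrib, expect_sub_distrib, Fintype.expect_const, ← mul_expect]
      rw [← hμ]; ring
    nlinarith [sq_nonneg μ]
  have hs := (expect_sum_centered hc m).2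
  have heq : ∀ x : Fin m → Ω, (∑ k, f (x k)) / m - μ = (∑ k, (f (x k) - μ)) / m := fun x => by
    rw [sum_sub_distrib]; simp; field_simp
  simp only [heq]
  refine (unifProb_abs_ge_le _ ha).trans ?_
  simp only [div_pow, ← expect_div, hs]
  rw [div_div, div_le_div_iff₀ (by positivity) (by norm_num)]
  nlinarith [mul_le_mul_of_nonneg_left hv hmR.le, mul_le_mul_of_nonneg_left hm hmR.le]

open Classical in
/-- If each of `m` independent trials is bad with probability at most `1/16`, then at least half of
them are bad with probability at most `2⁻ᵐ`. The event is dominated by a product of weights, `4` for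
a bad and `1/4` for a good trial, each of expectation at most `1/2`. -/
lemma unifProb_half_bad_le {p : Ω → Prop} (hp : unifProb p ≤ 1 / 16) (m : ℕ) [Nonempty Ω] :
    unifProb (fun x : Fin m → Ω => m ≤ 2 * (univ.filter fun l => p (x l)).card) ≤ (1 / 2) ^ m := by
  set w : Ω → ℝ := fun ω => if p ω then 4 else 1 / 4 with hw
  have hE : 𝔼 ω, w ω ≤ 1 / 2 := by
    have h : ∀ ω, w ω = 15 / 4 * (if p ω then 1 else 0) + 1 / 4 := fun ω => by
      simp only [hw]; split_ifs <;> norm_num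
    have hp' : (𝔼 ω, if p ω then (1 : ℝ) else 0) ≤ 1 / 16 := hp
    simp only [h, expect_add_distrib, Fintype.expect_const, ← mul_expect]
    linarith
  have hE0 : 0 ≤ 𝔼 ω, w ω := expect_nonneg fun ω _ => by simp only [hw]; split_ifs <;> norm_num
  calc _ ≤ 𝔼 x : Fin m → Ω, ∏ l, w (x l) := by
        refine expect_le_expect fun x _ => ?_
        have hprod : ∏ l, w (x l) = 4 ^ (univ.filter fun l => p (x l)).card *
            (1 / 4) ^ (univ.filter fun l => ¬ p (x l)).card := by
          simp only [hw]; rw [prod_ite]; simp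
        have hcard : (univ.filter fun l => p (x l)).card +
            (univ.filter fun l => ¬ p (x l)).card = m := by
          simpa using card_filter_add_card_filter_not (s := (univ : Finset (Fin m)))
            (fun l => p (x l))
        split_ifs with h
        · rw [hprod, one_div, inv_pow, ← div_eq_mul_inv, one_le_div (by positivity)]
          exact pow_le_pow_right₀ (by norm_num) (by omega)
        · rw [hprod]; positivity
    _ = (𝔼 ω, w ω) ^ m := by rw [expect_pi_prod (fun _ => w)]; simp
    _ ≤ (1 / 2) ^ m := pow_le_pow_left₀ hE0 hE m

/-- The largest value `z l` that has more than half of the values of `z` at or above it. (For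
`m = 0` there is none, and the result is `0`.) -/
noncomputable def upperMedian {m : ℕ} (z : Fin m → ℝ) : ℝ :=
  if h : (univ.filter fun l => m < 2 * (univ.filter fun l' => z l ≤ z l').card).Nonempty
  then (univ.filter fun l => m < 2 * (univ.filter fun l' => z l ≤ z l').card).sup' h z else 0

open Classical in
lemma abs_upperMedian_sub_lt {m : ℕ} (z : Fin m → ℝ) {μ a : ℝ}
    (h : ¬ m ≤ 2 * (univ.filter fun l => a ≤ |z l - μ|).card) : |upperMedian z - μ| < a := by
  set G := univ.filter fun l => ¬ a ≤ |z l - μ| with hG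
  have hcard : (univ.filter fun l => a ≤ |z l - μ|).card + G.card = m := by
    simpa [hG, -not_le] using card_filter_add_card_filter_not (s := (univ : Finset (Fin m)))
      (fun l => a ≤ |z l - μ|)
  have hmG : m < 2 * G.card := by omega
  have hGne : G.Nonempty := by rw [← card_pos]; omega
  obtain ⟨l₀, hl₀, hmin⟩ := exists_min_image G z hGne
  have hl₀' : l₀ ∈ univ.filter fun l => m < 2 * (univ.filter fun l' => z l ≤ z l').card := by
    rw [mem_filter]
    refine ⟨mem_univ _, hmG.trans_le ?_⟩
    exact Nat.mul_le_mul_left 2 (card_le_card fun l hl => by simpa using hmin l hl)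
  have hne : (univ.filter fun l => m < 2 * (univ.filter fun l' => z l ≤ z l').card).Nonempty :=
    ⟨l₀, hl₀'⟩
  rw [upperMedian, dif_pos hne]
  obtain ⟨l₁, hl₁, he⟩ := exists_mem_eq_sup' hne z
  have hle : z l₀ ≤ z l₁ := he ▸ le_sup' z hl₀'
  rw [he]
  rw [mem_filter] at hl₁
  -- Two sets of more than half of the indices intersect.
  have hinter : ((univ.filter fun l' => z l₁ ≤ z l') ∩ G).Nonempty := by
    rw [← card_pos]
    have h1 := card_union_add_card_inter (univ.filter fun l' => z l₁ ≤ z l') G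
    have h2 := card_le_univ ((univ.filter fun l' => z l₁ ≤ z l') ∪ G)
    simp only [Fintype.card_fin] at h2
    omega
  obtain ⟨l₂, hl₂⟩ := hinter
  rw [mem_inter, mem_filter, hG, mem_filter, not_le, abs_lt] at hl₂
  rw [hG, mem_filter, not_le, abs_lt] at hl₀
  rw [abs_lt]
  exact ⟨by linarith [hl₀.2.1], by linarith [hl₂.1.2, hl₂.2.2.2]⟩

/-- The median of the averages of the rows of an array of values. -/
noncomputable def medianOfMeans {L m : ℕ} (z : Fin L → Fin m → ℝ) : ℝ :=
  upperMedian fun l => (∑ k, z l k) / m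

lemma unifProb_medianOfMeans_ge_le [Nonempty Ω] (f : Ω → ℝ) {σ a : ℝ} (hσ : 𝔼 ω, f ω ^ 2 ≤ σ)
    (ha : 0 < a) {m : ℕ} (hm : 16 * σ ≤ m * a ^ 2) (hm0 : 0 < m) (L : ℕ) :
    unifProb (fun x : Fin L → Fin m → Ω =>
      a ≤ |medianOfMeans (fun l k => f (x l k)) - 𝔼 ω, f ω|) ≤ (1 / 2) ^ L := by
  classical
  refine le_trans (unifProb_mono fun x hx => ?_)
    (unifProb_half_bad_le (unifProb_average_ge_le f hσ ha hm hm0) L)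
  by_contra hcon
  refine absurd hx (not_le.2 (abs_upperMedian_sub_lt _ ?_))
  convert hcon

end FiniteProbability

/-! ### Adaptive algorithms with yes/no queries -/

/-- A deterministic adaptive algorithm that asks yes/no queries from `Q` and returns an element of
`α`. -/
inductive QueryTree (Q α : Type) : Type
  | done (a : α) : QueryTree Q α
  | ask (q : Q) (next : Bool → QueryTree Q α) : QueryTree Q α

namespace QueryTree

variable {Q α β : Type}

/-- The value returned when the queries are answered by `o`. -/
def eval (o : Q → Bool) : QueryTree Q α → α
  | done a => a
  | ask q next => (next (o q)).eval o

/-- The queries asked when they are answered by `o`. -/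
def asked (o : Q → Bool) : QueryTree Q α → List Q
  | done _ => []
  | ask q next => q :: (next (o q)).asked o

/-- Sequential composition. -/
def bind : QueryTree Q α → (α → QueryTree Q β) → QueryTree Q β
  | done a, f => f a
  | ask q next, f => ask q fun b => (next b).bind f

/-- The tree asking a single query. -/
def query (q : Q) : QueryTree Q Bool := ask q done

/-- Run finitely many trees one after the other. -/
def sequence : {m : ℕ} → (Fin m → QueryTree Q α) → QueryTree Q (Fin m → α)
  | 0, _ => done Fin.elim0
  | _ + 1, t => (t 0).bind fun a => (sequence fun k => t k.succ).bind fun f => done (Fin.cons a f)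

@[simp] lemma eval_bind (o : Q → Bool) (t : QueryTree Q α) (f : α → QueryTree Q β) :
    (t.bind f).eval o = (f (t.eval o)).eval o := by
  induction t with
  | done a => rfl
  | ask q next ih => exact ih (o q)

lemma asked_bind (o : Q → Bool) (t : QueryTree Q α) (f : α → QueryTree Q β) :
    (t.bind f).asked o = t.asked o ++ (f (t.eval o)).asked o := by
  induction t with
  | done a => rfl
  | ask q next ih => simp only [bind, asked, ih, eval, List.cons_append]

@[simp] lemma eval_sequence (o : Q → Bool) {m : ℕ} (t : Fin m → QueryTree Q α) :
    (sequence t).eval o = fun k => (t k).eval o := by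
  induction m with
  | zero => funext k; exact k.elim0
  | succ m ih =>
    funext k
    simp only [sequence, eval_bind, ih, eval]
    refine Fin.cases ?_ (fun k => ?_) k <;> simp

lemma length_asked_sequence_le (o : Q → Bool) {m b : ℕ} (t : Fin m → QueryTree Q α)
    (h : ∀ k, ((t k).asked o).length ≤ b) : ((sequence t).asked o).length ≤ m * b := by
  induction m with
  | zero => simp [sequence, asked]
  | succ m ih =>
    have h1 := ih (fun k => t k.succ) fun k => h k.succ
    have h0 := h 0
    simp only [sequence, asked_bind, asked, List.length_append, List.length_nil]
    rw [add_mul, one_mul]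
    omega

lemma eval_congr {o o' : Q → Bool} (t : QueryTree Q α) (h : ∀ q ∈ t.asked o, o' q = o q) :
    t.eval o' = t.eval o := by
  induction t with
  | done a => rfl
  | ask q next ih =>
    have hq : o' q = o q := h q (by simp [asked])
    simp only [eval, hq]
    exact ih _ fun q' hq' => h q' (by simp [asked, hq'])

end QueryTree

/-! ### Hitting queries and their simulation by inner products -/

/-- A hitting query `(i, S)` asks whether the `i`-th rows of the two matrices differ somewhere
in `S`. -/
abbrev HitQuery (n : ℕ) : Type := Fin n × Finset (Fin n)

section Simulation

variable {n : ℕ}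

/-- The positions at which the `i`-th rows of `A` and `B` differ. -/
noncomputable def diffRow (A B : Matrix (Fin n) (Fin n) ℝ) (i : Fin n) : Finset (Fin n) :=
  univ.filter fun j => A i j ≠ B i j

/-- The correct answers to hitting queries for a matrix with row supports `N`. -/
def hits (N : Fin n → Finset (Fin n)) (q : HitQuery n) : Bool :=
  decide ((N q.1 ∩ q.2).Nonempty)

/-- The indicator of `S` times the `0/1`-vector `v`. -/
def maskVector (S : Finset (Fin n)) (v : Fin n → Bool) : Fin n → Bool :=
  fun j => decide (j ∈ S) && v j

/-- The inner product of the `i`-th row of `M` with `v` masked by `S`, where `q = (i, S)`. -/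
noncomputable def maskedDot (M : Matrix (Fin n) (Fin n) ℝ) (q : HitQuery n) (v : Fin n → Bool) :
    ℝ :=
  ∑ j, M q.1 j * (if maskVector q.2 v j then (1 : ℝ) else 0)

open Classical in
/-- Ask for the inner products of the `i`-th rows of both matrices with the masked test vectors, up
to the first vector for which they differ, and tell whether there is one. -/
noncomputable def askHit (q : HitQuery n) :
    List (Fin n → Bool) → (Bool → IPAlgorithm n) → IPAlgorithm n
  | [], k => k false
  | v :: vs, k =>
    .ask ⟨.matA, .row, q.1, maskVector q.2 v⟩ fun a =>
      .ask ⟨.matB, .row, q.1, maskVector q.2 v⟩ fun b =>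
        if a = b then askHit q vs k else k true

open Classical in
/-- The answer to a hitting query computed from the test vectors. -/
noncomputable def testHit (A B : Matrix (Fin n) (Fin n) ℝ) (vs : List (Fin n → Bool))
    (q : HitQuery n) : Bool :=
  decide (∃ v ∈ vs, maskedDot A q v ≠ maskedDot B q v)

open Classical in
lemma testHit_cons (A B : Matrix (Fin n) (Fin n) ℝ) (v : Fin n → Bool) (vs : List (Fin n → Bool))
    (q : HitQuery n) : testHit A B (v :: vs) q =
      if maskedDot A q v = maskedDot B q v then testHit A B vs q else true := by
  split_ifs with h <;> simp [testHit, h]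

lemma run_askHit (A B : Matrix (Fin n) (Fin n) ℝ) (q : HitQuery n) (vs : List (Fin n → Bool))
    (k : Bool → IPAlgorithm n) :
    (askHit q vs k).run A B = (k (testHit A B vs q)).run A B := by
  induction vs with
  | nil => simp [askHit, testHit]
  | cons v vs ih =>
    change (if maskedDot A q v = maskedDot B q v then askHit q vs k else k true).run A B = _
    rw [testHit_cons]
    split_ifs with h
    · exact ih
    · rfl

lemma numQueries_askHit_le (A B : Matrix (Fin n) (Fin n) ℝ) (q : HitQuery n)
    (vs : List (Fin n → Bool)) (k : Bool → IPAlgorithm n) :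
    (askHit q vs k).numQueries A B ≤ 2 * vs.length + (k (testHit A B vs q)).numQueries A B := by
  induction vs with
  | nil => simp [askHit, testHit]
  | cons v vs ih =>
    change (if maskedDot A q v = maskedDot B q v then askHit q vs k else k true).numQueries A B
      + 1 + 1 ≤ _
    rw [testHit_cons, List.length_cons]
    split_ifs with h <;> omega

/-- Replace the hitting queries of a tree by inner product queries with masked test vectors. -/
noncomputable def QueryTree.toIP (vs : List (Fin n → Bool)) :
    QueryTree (HitQuery n) ℝ → IPAlgorithm n
  | .done d => .output d
  | .ask q next => askHit q vs fun b => (next b).toIP vs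

lemma QueryTree.run_toIP (A B : Matrix (Fin n) (Fin n) ℝ) (vs : List (Fin n → Bool))
    (t : QueryTree (HitQuery n) ℝ) : (t.toIP vs).run A B = t.eval (testHit A B vs) := by
  induction t with
  | done d => rfl
  | ask q next ih => simp only [toIP, run_askHit, ih, eval]

lemma QueryTree.numQueries_toIP_le (A B : Matrix (Fin n) (Fin n) ℝ) (vs : List (Fin n → Bool))
    (t : QueryTree (HitQuery n) ℝ) :
    (t.toIP vs).numQueries A B ≤ 2 * vs.length * (t.asked (testHit A B vs)).length := by
  induction t with
  | done d => simp [toIP, IPAlgorithm.numQueries]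
  | ask q next ih =>
    simp only [toIP, asked, List.length_cons]
    refine (numQueries_askHit_le A B q vs _).trans ?_
    have := ih (testHit A B vs q)
    rw [mul_add, mul_one]
    omega

/-- A random `0/1`-vector is orthogonal to a nonzero real vector with probability at most `1/2`:
flipping one coordinate at which the real vector is nonzero changes the inner product. -/
lemma unifProb_dot_eq_zero_le {y : Fin n → ℝ} {j : Fin n} (hj : y j ≠ 0) :
    unifProb (fun v : Fin n → Bool => ∑ j, y j * (if v j then (1 : ℝ) else 0) = 0) ≤ 1 / 2 := by
  classical
  let flip : (Fin n → Bool) → (Fin n → Bool) := fun v => Function.update v j (!v j)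
  have hflip : Function.Involutive flip := fun v => by simp [flip]
  set p : (Fin n → Bool) → Prop := fun v => ∑ j, y j * (if v j then (1 : ℝ) else 0) = 0 with hp
  have h1 : unifProb p = unifProb fun v => p (flip v) :=
    Fintype.expect_equiv hflip.toPerm _ _ fun v => by
      change _ = if p (flip (flip v)) then (1 : ℝ) else 0
      rw [hflip v]
  have h2 : ∀ v, p v → ¬ p (flip v) := fun v hv hv' => by
    simp only [hp] at hv hv'
    rw [← add_sum_erase _ _ (mem_univ j)] at hv hv'
    have : ∑ i ∈ univ.erase j, y i * (if flip v i then (1 : ℝ) else 0) =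
        ∑ i ∈ univ.erase j, y i * (if v i then (1 : ℝ) else 0) :=
      sum_congr rfl fun i hi => by simp [flip, Function.update_of_ne (ne_of_mem_erase hi)]
    rw [this] at hv'
    have hd : y j * (if v j then (1 : ℝ) else 0) = y j * (if flip v j then (1 : ℝ) else 0) := by
      linarith
    cases hvj : v j <;> simp [flip, hvj, hj, Ne.symm hj] at hd
  have h3 : unifProb p + unifProb (fun v => p (flip v)) ≤ 1 := by
    rw [unifProb, unifProb, ← expect_add_distrib,
      ← Fintype.expect_const (ι := Fin n → Bool) (1 : ℝ)]
    refine expect_le_expect fun v _ => ?_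
    by_cases hv : p v
    · simp [hv, h2 v hv]
    · simp only [hv, if_false, zero_add]; split_ifs <;> norm_num
  linarith

lemma unifProb_testHit_ne_le (A B : Matrix (Fin n) (Fin n) ℝ) (q : HitQuery n) (m : ℕ) :
    unifProb (fun V : Fin m → Fin n → Bool =>
      testHit A B (List.ofFn V) q ≠ hits (diffRow A B) q) ≤ (1 / 2) ^ m := by
  classical
  set y : Fin n → ℝ := fun j => if j ∈ q.2 then A q.1 j - B q.1 j else 0 with hy
  have hdot : ∀ v : Fin n → Bool, maskedDot A q v = maskedDot B q v ↔
      ∑ j, y j * (if v j then (1 : ℝ) else 0) = 0 := fun v => by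
    rw [maskedDot, maskedDot, ← sub_eq_zero, ← sum_sub_distrib]
    refine Eq.congr (sum_congr rfl fun j _ => ?_) rfl
    by_cases h : j ∈ q.2 <;> cases hv : v j <;> simp [hy, maskVector, h, hv]
  have htest : ∀ vs, testHit A B vs q = true ↔
      ∃ v ∈ vs, ∑ j, y j * (if v j then (1 : ℝ) else 0) ≠ 0 := fun vs => by
    simp only [testHit, decide_eq_true_eq, ne_eq, hdot]
  have hhits : hits (diffRow A B) q = true ↔ ∃ j, y j ≠ 0 := by
    simp only [hits, decide_eq_true_eq, Finset.Nonempty, mem_inter, diffRow, mem_filter, mem_univ,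
      true_and]
    refine exists_congr fun j => ?_
    by_cases h : j ∈ q.2 <;> simp [hy, h, sub_eq_zero]
  by_cases hex : ∃ j, y j ≠ 0
  · obtain ⟨j, hj⟩ := hex
    have ht : hits (diffRow A B) q = true := hhits.2 ⟨j, hj⟩
    set p : (Fin n → Bool) → Prop := fun v => ∑ j, y j * (if v j then (1 : ℝ) else 0) = 0 with hp
    calc _ ≤ 𝔼 V : Fin m → Fin n → Bool, ∏ l, if p (V l) then (1 : ℝ) else 0 := by
          refine expect_le_expect fun V _ => ?_
          split_ifs with h
          · rw [prod_congr rfl fun l _ => if_pos ?_]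
            · simp
            · rw [ht] at h
              by_contra hl
              exact h ((htest _).2 ⟨V l, by simp, hl⟩)
          · exact prod_nonneg fun l _ => by split_ifs <;> norm_num
      _ = (unifProb p) ^ m := by
          rw [expect_pi_prod (fun _ v => if p v then (1 : ℝ) else 0)]; simp [unifProb]
      _ ≤ (1 / 2) ^ m := pow_le_pow_left₀ (unifProb_nonneg _) (unifProb_dot_eq_zero_le hj) m
  · have hy0 : ∀ j, y j = 0 := by simpa using hex
    have hf : ∀ vs, testHit A B vs q = hits (diffRow A B) q := fun vs => by
      rw [Bool.eq_iff_iff, htest, hhits]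
      simp [hy0]
    simp only [hf, ne_eq, not_true_eq_false, unifProb, if_false, expect_const_zero]
    positivity

/-- The simulated tree returns the intended value unless one of the queries on the path given by
the correct answers is answered incorrectly. That path does not depend on the test vectors, hence
the same vectors can be used for all of its queries. -/
lemma unifProb_run_toIP_ne_le (A B : Matrix (Fin n) (Fin n) ℝ) (t : QueryTree (HitQuery n) ℝ)
    (m : ℕ) :
    unifProb (fun V : Fin m → Fin n → Bool =>
      (t.toIP (List.ofFn V)).run A B ≠ t.eval (hits (diffRow A B))) ≤
      (t.asked (hits (diffRow A B))).length * (1 / 2) ^ m := by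
  classical
  set l := t.asked (hits (diffRow A B)) with hl
  refine le_trans (unifProb_mono (q := fun V => ∃ q ∈ l.toFinset,
    testHit A B (List.ofFn V) q ≠ hits (diffRow A B) q) fun V hV => ?_) ?_
  · by_contra hcon
    push Not at hcon
    refine hV ?_
    rw [QueryTree.run_toIP]
    exact QueryTree.eval_congr t fun q hq => hcon q (by simpa [hl] using hq)
  · refine (unifProb_exists_le_card _ _ fun q _ => unifProb_testHit_ne_le A B q m).trans ?_
    have : ((l.toFinset.card : ℕ) : ℝ) ≤ l.length := by exact_mod_cast l.toFinset_card_le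
    exact mul_le_mul_of_nonneg_right this (by positivity)

end Simulation

/-! ### Uniformly random elements of a row -/

section RandomElement

variable {n : ℕ}

/-- The element of `s` that comes first in a uniformly random order is uniformly distributed
in `s`. -/
lemma expect_perm_first {s : Finset (Fin n)} (hs : s.Nonempty) {J : Equiv.Perm (Fin n) → Fin n}
    (hJ : ∀ π, J π ∈ s ∧ ∀ j ∈ s, π (J π) ≤ π j) (F : Fin n → ℝ) :
    𝔼 π, F (J π) = (∑ j ∈ s, F j) / s.card := by
  classical
  set p : Fin n → ℝ := fun j => 𝔼 π, if J π = j then (1 : ℝ) else 0 with hp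
  have huniq : ∀ π j, j ∈ s → (∀ k ∈ s, π j ≤ π k) → J π = j := fun π j hj hmin =>
    π.injective (le_antisymm ((hJ π).2 j hj) (hmin _ (hJ π).1))
  -- Exchanging `j` and `k` in the order exchanges the events `J π = j` and `J π = k`.
  have hswap : ∀ j ∈ s, ∀ k ∈ s, p j = p k := fun j hj k hk => by
    have hmem : ∀ x ∈ s, Equiv.swap j k x ∈ s := fun x hx => by
      by_cases h1 : x = j
      · rw [h1, Equiv.swap_apply_left]; exact hk
      by_cases h2 : x = k
      · rw [h2, Equiv.swap_apply_right]; exact hj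
      rwa [Equiv.swap_apply_of_ne_of_ne h1 h2]
    have hJs : ∀ π : Equiv.Perm (Fin n),
        J (π * Equiv.swap j k) = Equiv.swap j k (J π) := fun π => by
      refine huniq _ _ (hmem _ (hJ π).1) fun x hx => ?_
      simpa using (hJ π).2 _ (hmem x hx)
    refine Fintype.expect_equiv (Equiv.mulRight (Equiv.swap j k)) _ _ fun π => ?_
    simp only [Equiv.coe_mulRight, hJs]
    refine if_congr ?_ rfl rfl
    rw [Equiv.swap_apply_eq_iff, Equiv.swap_apply_right]
  have hF : ∀ G : Fin n → ℝ, 𝔼 π, G (J π) = ∑ j ∈ s, p j * G j := fun G => by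
    have : ∀ π, G (J π) = ∑ j ∈ s, (if J π = j then (1 : ℝ) else 0) * G j := fun π => by
      simp [sum_ite_eq, (hJ π).1]
    simp only [this, expect_sum_comm, hp, expect_mul]
  obtain ⟨j₀, hj₀⟩ := hs
  have hcard : (s.card : ℝ) ≠ 0 := by
    exact_mod_cast (card_pos.2 ⟨j₀, hj₀⟩).ne'
  have hconst : ∀ G : Fin n → ℝ, ∑ j ∈ s, p j * G j = p j₀ * ∑ j ∈ s, G j := fun G => by
    rw [mul_sum]; exact sum_congr rfl fun j hj => by rw [hswap j hj j₀ hj₀]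
  have h1 : p j₀ * s.card = 1 := by
    have h := hF fun _ => 1
    rw [hconst, Fintype.expect_const] at h
    simpa using h.symm
  rw [hF, hconst, eq_div_iff hcard]
  linear_combination (∑ j ∈ s, F j) * h1

/-- The set of the first `m` elements in the order given by `π`. -/
def prefixSet (π : Equiv.Perm (Fin n)) (m : ℕ) : Finset (Fin n) :=
  univ.filter fun j => (π j : ℕ) < m

/-- Binary search, among the `2 ^ b` positions from `m` on, for the position of the first element of
row `i` in the order given by `π`. A hit among the first `m + 2 ^ b` elements means that the
position is in the lower half. -/
def searchFirst (π : Equiv.Perm (Fin n)) (i : Fin n) : ℕ → ℕ → QueryTree (HitQuery n) ℕ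
  | 0, m => .done m
  | b + 1, m => .ask (i, prefixSet π (m + 2 ^ b)) fun h =>
      searchFirst π i b (if h then m else m + 2 ^ b)

lemma length_asked_searchFirst (o : HitQuery n → Bool) (π : Equiv.Perm (Fin n)) (i : Fin n)
    (b m : ℕ) : ((searchFirst π i b m).asked o).length = b := by
  induction b generalizing m with
  | zero => rfl
  | succ b ih => simp only [searchFirst, QueryTree.asked, List.length_cons, ih]

lemma eval_searchFirst {N : Fin n → Finset (Fin n)} {π : Equiv.Perm (Fin n)} {i j : Fin n}
    (hj : j ∈ N i) (hmin : ∀ k ∈ N i, π j ≤ π k) {b m : ℕ} (h1 : m ≤ π j)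
    (h2 : (π j : ℕ) < m + 2 ^ b) : (searchFirst π i b m).eval (hits N) = π j := by
  have hhit : ∀ m, hits N (i, prefixSet π m) = true ↔ (π j : ℕ) < m := fun m => by
    simp only [hits, decide_eq_true_eq, Finset.Nonempty, mem_inter, prefixSet, mem_filter, mem_univ,
      true_and]
    exact ⟨fun ⟨k, hk, hlt⟩ => lt_of_le_of_lt (hmin k hk) hlt, fun h => ⟨j, hj, h⟩⟩
  induction b generalizing m with
  | zero => simp only [searchFirst, QueryTree.eval]; omega
  | succ b ih =>
    simp only [searchFirst, QueryTree.eval]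
    rw [pow_succ] at h2
    by_cases h : (π j : ℕ) < m + 2 ^ b
    · rw [if_pos ((hhit _).2 h)]; exact ih h1 h
    · rw [if_neg fun h' => h ((hhit _).1 h')]; exact ih (by omega) (by omega)

/-- Find the first element of row `i` in the order given by `π`; for an empty row the result is
meaningless, but the sample value is then `0` if the size estimate of the row is. -/
def firstInRow (b : ℕ) (π : Equiv.Perm (Fin n)) (i : Fin n) : QueryTree (HitQuery n) (Fin n) :=
  (searchFirst π i b 0).bind fun m => .done (if h : m < n then π.symm ⟨m, h⟩ else i)

lemma length_asked_firstInRow (o : HitQuery n → Bool) (b : ℕ) (π : Equiv.Perm (Fin n))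
    (i : Fin n) : ((firstInRow b π i).asked o).length = b := by
  simp [firstInRow, QueryTree.asked_bind, QueryTree.asked, length_asked_searchFirst]

lemma eval_firstInRow {N : Fin n → Finset (Fin n)} {i : Fin n} (hi : (N i).Nonempty) {b : ℕ}
    (hb : n ≤ 2 ^ b) (π : Equiv.Perm (Fin n)) :
    (firstInRow b π i).eval (hits N) ∈ N i ∧
      ∀ k ∈ N i, π ((firstInRow b π i).eval (hits N)) ≤ π k := by
  obtain ⟨j, hj, hmin⟩ := exists_min_image (N i) π hi
  have : (firstInRow b π i).eval (hits N) = j := by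
    rw [firstInRow, QueryTree.eval_bind,
      eval_searchFirst hj hmin (Nat.zero_le _) (by have := (π j).isLt; omega)]
    simp [QueryTree.eval]
  rw [this]
  exact ⟨hj, hmin⟩

lemma expect_firstInRow {N : Fin n → Finset (Fin n)} {i : Fin n} (hi : (N i).Nonempty) {b : ℕ}
    (hb : n ≤ 2 ^ b) (F : Fin n → ℝ) :
    𝔼 π, F ((firstInRow b π i).eval (hits N)) = (∑ j ∈ N i, F j) / (N i).card :=
  expect_perm_first hi (fun π => eval_firstInRow hi hb π) F

end RandomElement

/-! ### Estimating the number of elements of a row -/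

section RowSize

variable {n : ℕ}

/-- The set of the first `m` terms of the sequence `x`. -/
def termSet {M : ℕ} (x : Fin M → Fin n) (m : ℕ) : Finset (Fin n) :=
  (univ.filter fun t : Fin M => (t : ℕ) < m).image x

open Classical in
lemma expect_termSet_miss (hn : 0 < n) (s : Finset (Fin n)) {M m : ℕ} (hm : m ≤ M) :
    𝔼 x : Fin M → Fin n, (if (s ∩ termSet x m).Nonempty then (0 : ℝ) else 1) =
      (1 - s.card / n) ^ m := by
  have : Nonempty (Fin n) := ⟨⟨0, hn⟩⟩
  have hnR : (n : ℝ) ≠ 0 := by exact_mod_cast hn.ne'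
  have h1 : ∀ x : Fin M → Fin n, (if (s ∩ termSet x m).Nonempty then (0 : ℝ) else 1) =
      ∏ t : Fin M, if (t : ℕ) < m ∧ x t ∈ s then (0 : ℝ) else 1 := fun x => by
    have hiff : (s ∩ termSet x m).Nonempty ↔ ∃ t : Fin M, (t : ℕ) < m ∧ x t ∈ s := by
      simp only [Finset.Nonempty, mem_inter, termSet, mem_image, mem_filter, mem_univ, true_and]
      constructor
      · rintro ⟨_, hs, t, ht, rfl⟩; exact ⟨t, ht, hs⟩
      · rintro ⟨t, ht, hs⟩; exact ⟨_, hs, t, ht, rfl⟩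
    split_ifs with h
    · obtain ⟨t, ht⟩ := hiff.1 h
      symm; exact prod_eq_zero (mem_univ t) (if_pos ht)
    · rw [hiff] at h
      push Not at h
      symm; exact prod_eq_one fun t _ => if_neg fun ht => h t ht.1 ht.2
  have h2 : 𝔼 a : Fin n, (if a ∈ s then (0 : ℝ) else 1) = 1 - s.card / n := by
    rw [Fintype.expect_eq_sum_div_card]
    have : ∀ a : Fin n, (if a ∈ s then (0 : ℝ) else 1) = 1 - if a ∈ s then 1 else 0 := fun a => by
      split_ifs <;> norm_num
    simp only [this, sum_sub_distrib]
    simp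
    field_simp
  simp only [h1]
  rw [expect_pi_prod (fun (t : Fin M) a => if (t : ℕ) < m ∧ a ∈ s then (0 : ℝ) else 1)]
  have h3 : ∀ t : Fin M, 𝔼 a : Fin n, (if (t : ℕ) < m ∧ a ∈ s then (0 : ℝ) else 1) =
      if (t : ℕ) < m then (1 - s.card / n : ℝ) else 1 := fun t => by
    by_cases ht : (t : ℕ) < m
    · simp only [ht, true_and, if_true, h2]
    · simp only [ht, false_and, if_false, Fintype.expect_const]
  simp only [h3]
  rw [prod_ite, prod_const, prod_const_one, mul_one]
  congr 1
  rw [Fin.card_filter_val_lt, min_eq_right hm]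

/-- Densities that differ by a factor of more than `1 + e` have miss probabilities that differ by
at least `e / 24` at some scale `2 ^ k`, namely one where `2 ^ k` times the larger density is
about `1/2`. -/
lemma exists_scale_gap {p p' e : ℝ} {ℓ : ℕ} (hp : 0 ≤ p) (he : 0 < e) (he1 : e ≤ 1)
    (hpp : (1 + e) * p < p') (hp1 : p' ≤ 1) (hℓ : 1 ≤ p' * 2 ^ ℓ) :
    ∃ k : Fin (ℓ + 1), e / 24 ≤ (1 - p) ^ 2 ^ (k : ℕ) - (1 - p') ^ 2 ^ (k : ℕ) := by
  have hp0 : 0 < p' := lt_of_le_of_lt (by positivity) hpp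
  have hu : e * p' / 2 ≤ p' - p := by
    by_contra hcon
    have h1 : p' * (1 - e / 2) < p := by linarith
    nlinarith [mul_lt_mul_of_pos_left h1 (by linarith : 0 < 1 + e),
      mul_nonneg (mul_nonneg he.le hp0.le) (sub_nonneg.2 he1)]
  rcases lt_or_ge (1 / 2) p' with h | h
  · exact ⟨0, by simp; nlinarith⟩
  obtain ⟨k, hk1, hk2⟩ := exists_nat_pow_near (x := 1 / (2 * p')) (y := (2 : ℝ))
    (by rw [le_div_iff₀ (by positivity)]; linarith) one_lt_two
  rw [le_div_iff₀ (by positivity)] at hk1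
  rw [div_lt_iff₀ (by positivity), pow_succ] at hk2
  have hkℓ : k < ℓ + 1 := by
    by_contra hcon
    have : (2 : ℝ) ^ (ℓ + 1) ≤ 2 ^ k := pow_le_pow_right₀ (by norm_num) (by omega)
    rw [pow_succ] at this
    nlinarith
  refine ⟨⟨k, hkℓ⟩, ?_⟩
  simp only
  set t : ℕ := 2 ^ k with ht
  have htR : (t : ℝ) = 2 ^ k := by rw [ht]; push_cast; rfl
  rw [← htR] at hk1 hk2
  set u := p' - p with hu'
  have hu0 : 0 < u := lt_of_lt_of_le (by positivity) hu
  have hu1 : u ≤ p' := by linarith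
  have hA : 1 / 2 ≤ (1 - p) ^ t := by
    have := one_add_mul_le_pow (a := -p) (by linarith) t
    rw [← sub_eq_add_neg] at this
    nlinarith
  have hB : (1 - p') ^ t ≤ (1 - p) ^ t * (1 - u) ^ t := by
    rw [← mul_pow]
    exact pow_le_pow_left₀ (by linarith) (by nlinarith) t
  have hC : (1 - u) ^ t * (1 + t * u) ≤ 1 := by
    have h1 := one_add_mul_le_pow (a := u) (by linarith) t
    have h2 : (1 - u) ^ t * (1 + u) ^ t ≤ 1 := by
      rw [← mul_pow]
      exact pow_le_one₀ (by nlinarith) (by nlinarith)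
    have h3 : 0 ≤ (1 - u) ^ t := pow_nonneg (by linarith) t
    nlinarith
  have htu : t * u ≤ 1 / 2 := by nlinarith
  have htu' : e / 8 ≤ t * u := by nlinarith
  have hD : (1 - u) ^ t ≤ 1 - 2 / 3 * (t * u) := by
    have h3 : 0 ≤ (1 - u) ^ t := pow_nonneg (by linarith) t
    by_contra hcon
    push Not at hcon
    have : (1 - 2 / 3 * (t * u)) * (1 + t * u) < (1 - u) ^ t * (1 + t * u) :=
      mul_lt_mul_of_pos_right hcon (by nlinarith)
    nlinarith
  nlinarith

/-- Some row size whose miss probabilities at the scales `2 ^ k` agree with `g` up to `δ`,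
and `0` if there is none. -/
noncomputable def decodeSize (n : ℕ) (δ : ℝ) {ℓ : ℕ} (g : Fin (ℓ + 1) → ℝ) : ℕ :=
  open Classical in
  if h : ∃ d : ℕ, d ≤ n ∧ ∀ k, |g k - (1 - d / n) ^ 2 ^ (k : ℕ)| ≤ δ then h.choose else 0

lemma le_of_miss_close {d d' ℓ : ℕ} {e : ℝ} {g : Fin (ℓ + 1) → ℝ} (hn : 0 < n)
    (hℓ : n ≤ 2 ^ ℓ) (he : 0 < e) (he1 : e ≤ 1) (hd' : d' ≤ n)
    (h : ∀ k, |g k - (1 - d / n) ^ 2 ^ (k : ℕ)| ≤ e / 50)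
    (h' : ∀ k, |g k - (1 - d' / n) ^ 2 ^ (k : ℕ)| ≤ e / 50) : (d' : ℝ) ≤ (1 + e) * d := by
  by_contra hcon
  push Not at hcon
  have hnR : (0 : ℝ) < n := by exact_mod_cast hn
  have hd1 : (1 : ℝ) ≤ d' := by
    have : (0 : ℝ) < d' := lt_of_le_of_lt (by positivity) hcon
    exact_mod_cast this
  have hℓR : (n : ℝ) ≤ 2 ^ ℓ := by exact_mod_cast hℓ
  obtain ⟨k, hk⟩ := exists_scale_gap (p := d / n) (p' := d' / n) (e := e) (ℓ := ℓ) (by positivity)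
    he he1 (by rw [← mul_div_assoc]; gcongr)
    (by rw [div_le_one hnR]; exact_mod_cast hd')
    (by rw [div_mul_eq_mul_div, le_div_iff₀ hnR]; nlinarith)
  have h1 := abs_le.1 (h k)
  have h2 := abs_le.1 (h' k)
  linarith [h1.1, h2.2]

/-- If `g` is close to the miss probabilities of a row of size `d`, then decoding finds a row size
consistent with `g` as well, hence close to `d`. -/
lemma decodeSize_close {d ℓ : ℕ} {e : ℝ} {g : Fin (ℓ + 1) → ℝ} (hn : 0 < n)
    (hℓ : n ≤ 2 ^ ℓ) (he : 0 < e) (he1 : e ≤ 1) (hd : d ≤ n)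
    (h : ∀ k, |g k - (1 - d / n) ^ 2 ^ (k : ℕ)| ≤ e / 50) :
    (decodeSize n (e / 50) g : ℝ) ≤ (1 + e) * d ∧
      (d : ℝ) ≤ (1 + e) * decodeSize n (e / 50) g := by
  have hex : ∃ d : ℕ, d ≤ n ∧ ∀ k, |g k - (1 - d / n) ^ 2 ^ (k : ℕ)| ≤ e / 50 := ⟨d, hd, h⟩
  rw [decodeSize, dif_pos hex]
  exact ⟨le_of_miss_close hn hℓ he he1 hex.choose_spec.1 h hex.choose_spec.2,
    le_of_miss_close hn hℓ he he1 hd hex.choose_spec.2 h⟩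

/-- The random choices of the row size estimator, shared by all rows: an `L × κ` array of random
sequences of length `2 ^ ℓ`. -/
abbrev SizeSeed (n ℓ L κ : ℕ) : Type := Fin L → Fin κ → Fin (2 ^ ℓ) → Fin n

/-- Estimate the size of row `i`: for each scale `2 ^ k`, the probability that `2 ^ k` random
elements miss the row is estimated by a median of means, and the estimates are decoded. -/
noncomputable def sizeTree {ℓ L κ : ℕ} (e : ℝ) (r : SizeSeed n ℓ L κ) (i : Fin n) :
    QueryTree (HitQuery n) ℕ :=
  (QueryTree.sequence fun k : Fin (ℓ + 1) => QueryTree.sequence fun l : Fin L =>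
    QueryTree.sequence fun m : Fin κ => QueryTree.query (i, termSet (r l m) (2 ^ (k : ℕ)))).bind
    fun h => .done (decodeSize n (e / 50) fun k =>
      medianOfMeans fun l m => if h k l m then (0 : ℝ) else 1)

lemma length_asked_sizeTree_le {ℓ L κ : ℕ} (o : HitQuery n → Bool) (e : ℝ)
    (r : SizeSeed n ℓ L κ) (i : Fin n) :
    ((sizeTree e r i).asked o).length ≤ (ℓ + 1) * (L * κ) := by
  simp only [sizeTree, QueryTree.asked_bind, QueryTree.asked, List.append_nil]
  refine QueryTree.length_asked_sequence_le _ _ fun k => ?_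
  refine QueryTree.length_asked_sequence_le _ _ fun l => ?_
  refine (QueryTree.length_asked_sequence_le (b := 1) _ _ fun m => ?_).trans_eq (mul_one κ)
  simp [QueryTree.query, QueryTree.asked]

/-- The estimate of the size of row `i` computed from correct answers. -/
noncomputable def sizeEstimate {ℓ L κ : ℕ} (N : Fin n → Finset (Fin n)) (e : ℝ)
    (r : SizeSeed n ℓ L κ) (i : Fin n) : ℕ :=
  (sizeTree e r i).eval (hits N)

/-- The vector `d` approximates the sizes of the rows up to a factor `1 + e`. -/
def ApproxSizes (N : Fin n → Finset (Fin n)) (e : ℝ) (d : Fin n → ℕ) : Prop :=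
  ∀ i, (d i : ℝ) ≤ (1 + e) * (N i).card ∧ ((N i).card : ℝ) ≤ (1 + e) * d i

lemma unifProb_not_approxSizes_le (N : Fin n → Finset (Fin n)) (hn : 0 < n) {ℓ L κ : ℕ} {e : ℝ}
    (hℓ : n ≤ 2 ^ ℓ) (he : 0 < e) (he1 : e ≤ 1) (hκ : 16 ≤ κ * (e / 50) ^ 2) :
    unifProb (fun r : SizeSeed n ℓ L κ => ¬ ApproxSizes N e (sizeEstimate N e r)) ≤
      (n * (ℓ + 1)) * (1 / 2) ^ L := by
  classical
  have : Nonempty (Fin n) := ⟨⟨0, hn⟩⟩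
  have hκ0 : 0 < κ := by
    rcases Nat.eq_zero_or_pos κ with h | h
    · rw [h] at hκ; norm_num at hκ
    · exact h
  set f : Fin n × Fin (ℓ + 1) → (Fin (2 ^ ℓ) → Fin n) → ℝ := fun ik x =>
    if (N ik.1 ∩ termSet x (2 ^ (ik.2 : ℕ))).Nonempty then (0 : ℝ) else 1 with hf
  have hmean : ∀ ik, 𝔼 x, f ik x = (1 - (N ik.1).card / n) ^ 2 ^ (ik.2 : ℕ) := fun ik =>
    expect_termSet_miss hn _ (Nat.pow_le_pow_right (by norm_num) (Nat.lt_succ_iff.1 ik.2.isLt))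
  refine le_trans (unifProb_mono (q := fun r : SizeSeed n ℓ L κ =>
    ∃ ik ∈ (univ : Finset (Fin n × Fin (ℓ + 1))),
      e / 50 ≤ |medianOfMeans (fun l m => f ik (r l m)) - 𝔼 x, f ik x|) fun r hr => ?_) ?_
  · by_contra hcon
    push Not at hcon
    refine hr fun i => ?_
    have hN : (N i).card ≤ n := by simpa using card_le_univ (N i)
    have hest : sizeEstimate N e r i = decodeSize n (e / 50) fun k : Fin (ℓ + 1) =>
        medianOfMeans fun l m => f (i, k) (r l m) := by
      simp only [sizeEstimate, sizeTree, QueryTree.eval_bind, QueryTree.eval_sequence,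
        QueryTree.query, QueryTree.eval, hits, hf, decide_eq_true_eq]
    rw [hest]
    refine decodeSize_close hn hℓ he he1 hN fun k => ?_
    have h := hcon (i, k) (mem_univ _)
    rw [hmean] at h
    exact h.le
  · refine (unifProb_exists_le_card _ _ (η := (1 / 2) ^ L) fun ik _ => ?_).trans (le_of_eq ?_)
    · refine unifProb_medianOfMeans_ge_le (f ik) (σ := 1) ?_ (by positivity) (by linarith) hκ0 L
      rw [← Fintype.expect_const (ι := Fin (2 ^ ℓ) → Fin n) (1 : ℝ)]
      exact expect_le_expect fun x _ => by simp only [hf]; split_ifs <;> norm_num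
    · simp

end RowSize

/-! ### The edge estimator -/

section EdgeEstimator

variable {n : ℕ}

/-- The weight of a pair whose first and second element have size estimates `a` and `b`. Each pair
and its reversal have total weight `2`. -/
noncomputable def pairWeight (a b : ℕ) : ℝ := if a < b then 2 else if a = b then 1 else 0

lemma pairWeight_nonneg (a b : ℕ) : 0 ≤ pairWeight a b := by
  unfold pairWeight; split_ifs <;> norm_num

lemma pairWeight_add_swap (a b : ℕ) : pairWeight a b + pairWeight b a = 2 := by
  unfold pairWeight
  rcases lt_trichotomy a b with h | h | h
  · rw [if_pos h, if_neg h.not_gt, if_neg h.ne']; norm_num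
  · subst h; norm_num
  · rw [if_neg h.not_gt, if_neg h.ne', if_pos h]; norm_num

lemma pairWeight_sq_le (a b : ℕ) : pairWeight a b ^ 2 ≤ if a ≤ b then 4 else 0 := by
  unfold pairWeight; split_ifs <;> first | omega | norm_num

/-- The number of pairs `(i, j)` with `j ∈ N i`. -/
def pairCount (N : Fin n → Finset (Fin n)) : ℕ := ∑ i, (N i).card

lemma sum_pairWeight {N : Fin n → Finset (Fin n)} (hN : ∀ i j, j ∈ N i ↔ i ∈ N j)
    (d : Fin n → ℕ) : ∑ i, ∑ j ∈ N i, pairWeight (d i) (d j) = pairCount N := by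
  have hswap : ∑ i, ∑ j ∈ N i, pairWeight (d i) (d j) =
      ∑ i, ∑ j ∈ N i, pairWeight (d j) (d i) :=
    sum_comm' fun i j => by simp [hN i j]
  have h2 : ∑ i, ∑ j ∈ N i, pairWeight (d i) (d j) + ∑ i, ∑ j ∈ N i, pairWeight (d j) (d i) =
      2 * pairCount N := by
    simp only [← sum_add_distrib, pairWeight_add_swap]
    rw [pairCount, Nat.cast_sum, mul_sum]
    exact sum_congr rfl fun i _ => by simp [mul_comm]
  linarith

/-- Up to a constant factor, a row has at most `√D` elements whose rows are at least as large as
itself, where `D` is the number of pairs: the sizes of these rows add up to at most `D`. -/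
lemma card_larger_le {N : Fin n → Finset (Fin n)} {e : ℝ} (he : 0 ≤ e) {d : Fin n → ℕ}
    (hd : ApproxSizes N e d) (i : Fin n) :
    (((N i).filter fun j => d i ≤ d j).card : ℝ) ≤ (1 + e) * √(pairCount N) := by
  set U := (N i).filter fun j => d i ≤ d j with hU
  have h1 : (U.card : ℝ) ≤ (N i).card := by exact_mod_cast card_filter_le _ _
  have h2 : (U.card : ℝ) * (N i).card ≤ (1 + e) ^ 2 * pairCount N := by
    calc (U.card : ℝ) * (N i).card = ∑ _j ∈ U, ((N i).card : ℝ) := by simp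
      _ ≤ ∑ j ∈ U, (1 + e) ^ 2 * ((N j).card : ℝ) := by
          refine sum_le_sum fun j hj => ?_
          have hij : (d i : ℝ) ≤ d j := by exact_mod_cast (mem_filter.1 hj).2
          have := (hd i).2
          have := (hd j).1
          have : (1 + e) * (d i : ℝ) ≤ (1 + e) * d j := by gcongr
          have : (1 + e) * (d j : ℝ) ≤ (1 + e) * ((1 + e) * (N j).card) := by gcongr
          nlinarith
      _ ≤ ∑ j, (1 + e) ^ 2 * ((N j).card : ℝ) :=
          sum_le_sum_of_subset_of_nonneg (subset_univ _) fun j _ _ => by positivity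
      _ = (1 + e) ^ 2 * pairCount N := by rw [← mul_sum, pairCount, Nat.cast_sum]
  refine le_of_sq_le_sq ?_ (by positivity)
  rw [mul_pow, Real.sq_sqrt (Nat.cast_nonneg _)]
  nlinarith [(Nat.cast_nonneg U.card : (0 : ℝ) ≤ U.card)]

/-- Sample once: for a random `i` and a random order `π`, the value is `n` times the size estimate
of row `i` times the weight of the pair of `i` and the first element of its row. -/
noncomputable def sampleTree {ℓ L κ : ℕ} (e : ℝ) (r : SizeSeed n ℓ L κ)
    (s : Fin n × Equiv.Perm (Fin n)) : QueryTree (HitQuery n) ℝ :=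
  (sizeTree e r s.1).bind fun a => (firstInRow ℓ s.2 s.1).bind fun j =>
    (sizeTree e r j).bind fun b => .done (n * a * pairWeight a b)

lemma length_asked_sampleTree_le {ℓ L κ : ℕ} (o : HitQuery n → Bool) (e : ℝ)
    (r : SizeSeed n ℓ L κ) (s : Fin n × Equiv.Perm (Fin n)) :
    ((sampleTree e r s).asked o).length ≤ 2 * ((ℓ + 1) * (L * κ)) + ℓ := by
  simp only [sampleTree, QueryTree.asked_bind, QueryTree.asked, List.length_append,
    List.append_nil, length_asked_firstInRow]
  have h1 := length_asked_sizeTree_le o e r s.1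
  have h2 := length_asked_sizeTree_le o e r ((firstInRow ℓ s.2 s.1).eval o)
  omega

/-- The mean over the random row and the random order is a sum over all pairs, in which every row is
averaged over its elements. -/
lemma expect_pair {N : Fin n → Finset (Fin n)} {ℓ : ℕ} (hn : 0 < n) (hℓ : n ≤ 2 ^ ℓ)
    (c : Fin n → ℝ) (hc : ∀ i, (N i).card = 0 → c i = 0) (H : Fin n → Fin n → ℝ) :
    𝔼 s : Fin n × Equiv.Perm (Fin n), n * (c s.1 * H s.1 ((firstInRow ℓ s.2 s.1).eval (hits N))) =
      ∑ i, c i / (N i).card * ∑ j ∈ N i, H i j := by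
  have hnR : (n : ℝ) ≠ 0 := by exact_mod_cast hn.ne'
  rw [expect_prod_eq]
  simp only [← mul_expect]
  rw [Fintype.expect_eq_sum_div_card, Fintype.card_fin, mul_div_cancel₀ _ hnR]
  refine sum_congr rfl fun i _ => ?_
  rcases (N i).eq_empty_or_nonempty with h | h
  · simp [hc i (by simp [h])]
  · rw [expect_firstInRow h hℓ]; ring

lemma eval_sampleTree {ℓ L κ : ℕ} (N : Fin n → Finset (Fin n)) (e : ℝ)
    (r : SizeSeed n ℓ L κ) (s : Fin n × Equiv.Perm (Fin n)) :
    (sampleTree e r s).eval (hits N) = n * (sizeEstimate N e r s.1 *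
      pairWeight (sizeEstimate N e r s.1)
        (sizeEstimate N e r ((firstInRow ℓ s.2 s.1).eval (hits N)))) := by
  simp only [sampleTree, QueryTree.eval_bind, QueryTree.eval, sizeEstimate]
  ring

lemma approxSizes_eq_zero {N : Fin n → Finset (Fin n)} {e : ℝ} {d : Fin n → ℕ}
    (hd : ApproxSizes N e d) {i : Fin n} (hi : (N i).card = 0) : (d i : ℝ) = 0 := by
  have h := (hd i).1
  rw [hi, Nat.cast_zero, mul_zero] at h
  exact le_antisymm h (Nat.cast_nonneg _)

/-- By symmetry the weights add up to the number of pairs, so the mean is off only by the relative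
error of the size estimates. -/
lemma abs_expect_sampleTree_sub_le {N : Fin n → Finset (Fin n)}
    (hN : ∀ i j, j ∈ N i ↔ i ∈ N j) (hn : 0 < n) {ℓ L κ : ℕ} (hℓ : n ≤ 2 ^ ℓ) {e : ℝ}
    (he : 0 ≤ e) {r : SizeSeed n ℓ L κ} (hr : ApproxSizes N e (sizeEstimate N e r)) :
    |(𝔼 s, (sampleTree e r s).eval (hits N)) - pairCount N| ≤ e * pairCount N := by
  set d := sizeEstimate N e r with hd
  simp only [eval_sampleTree]
  rw [expect_pair hn hℓ (fun i => (d i : ℝ)) (fun i hi => approxSizes_eq_zero hr hi)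
    (fun i j => pairWeight (d i) (d j))]
  rw [← sum_pairWeight hN d, ← sum_sub_distrib, mul_sum]
  refine (abs_sum_le_sum_abs _ _).trans (sum_le_sum fun i _ => ?_)
  have hw : 0 ≤ ∑ j ∈ N i, pairWeight (d i) (d j) := sum_nonneg fun j _ => pairWeight_nonneg _ _
  rcases (N i).eq_empty_or_nonempty with h | h
  · simp [h]
  · have hpos : (0 : ℝ) < (N i).card := by exact_mod_cast card_pos.2 h
    have h1 := (hr i).1
    have h2 := (hr i).2
    have habs : |(d i : ℝ) / (N i).card - 1| ≤ e := by
      rw [abs_le]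
      constructor
      · rw [le_sub_iff_add_le, le_div_iff₀ hpos]
        have : (1 - e) * ((N i).card : ℝ) ≤ d i := by
          rcases le_or_gt 1 e with h' | h'
          · nlinarith [(Nat.cast_nonneg (d i) : (0 : ℝ) ≤ d i)]
          · nlinarith [(Nat.cast_nonneg (d i) : (0 : ℝ) ≤ d i),
              mul_le_mul_of_nonneg_left h2 (sub_nonneg.2 h'.le)]
        linarith
      · rw [sub_le_iff_le_add, div_le_iff₀ hpos]; linarith
    have : (d i : ℝ) / (N i).card * ∑ j ∈ N i, pairWeight (d i) (d j) -
        ∑ j ∈ N i, pairWeight (d i) (d j) =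
        ((d i : ℝ) / (N i).card - 1) * ∑ j ∈ N i, pairWeight (d i) (d j) := by ring
    rw [this, abs_mul, abs_of_nonneg hw]
    exact mul_le_mul_of_nonneg_right habs hw

lemma expect_sampleTree_sq_le {N : Fin n → Finset (Fin n)} (hn : 0 < n) {ℓ L κ : ℕ}
    (hℓ : n ≤ 2 ^ ℓ) {e : ℝ} (he : 0 ≤ e) (he4 : e ≤ 1 / 4) {r : SizeSeed n ℓ L κ}
    (hr : ApproxSizes N e (sizeEstimate N e r)) :
    𝔼 s, (sampleTree e r s).eval (hits N) ^ 2 ≤ 8 * n * (pairCount N * √(pairCount N)) := by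
  set d := sizeEstimate N e r with hd
  have hsq : ∀ s : Fin n × Equiv.Perm (Fin n), (sampleTree e r s).eval (hits N) ^ 2 =
      n * ((n * (d s.1 : ℝ) ^ 2) *
        pairWeight (d s.1) (d ((firstInRow ℓ s.2 s.1).eval (hits N))) ^ 2) := fun s => by
    rw [eval_sampleTree]; ring
  simp only [hsq]
  rw [expect_pair hn hℓ (fun i => n * (d i : ℝ) ^ 2)
    (fun i hi => by simp [approxSizes_eq_zero hr hi]) (fun i j => pairWeight (d i) (d j) ^ 2)]
  have hterm : ∀ i, n * (d i : ℝ) ^ 2 / (N i).card * ∑ j ∈ N i, pairWeight (d i) (d j) ^ 2 ≤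
      8 * n * √(pairCount N) * (N i).card := fun i => by
    have hS : ∑ j ∈ N i, pairWeight (d i) (d j) ^ 2 ≤ 4 * ((1 + e) * √(pairCount N)) := by
      calc ∑ j ∈ N i, pairWeight (d i) (d j) ^ 2
          ≤ ∑ j ∈ N i, if d i ≤ d j then (4 : ℝ) else 0 :=
            sum_le_sum fun j _ => pairWeight_sq_le _ _
        _ = 4 * ((N i).filter fun j => d i ≤ d j).card := by
            rw [← sum_filter, sum_const, nsmul_eq_mul, mul_comm]
        _ ≤ _ := by gcongr; exact card_larger_le he hr i
    have hQ : (d i : ℝ) ^ 2 / (N i).card ≤ (1 + e) ^ 2 * (N i).card := by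
      refine div_le_of_le_mul₀ (Nat.cast_nonneg _) (by positivity) ?_
      calc (d i : ℝ) ^ 2 ≤ ((1 + e) * (N i).card) ^ 2 :=
            pow_le_pow_left₀ (Nat.cast_nonneg _) (hr i).1 2
        _ = _ := by ring
    have hc : (1 + e) ^ 3 ≤ 2 := by
      calc (1 + e) ^ 3 ≤ (1 + 1 / 4) ^ 3 := by gcongr
        _ ≤ 2 := by norm_num
    calc n * (d i : ℝ) ^ 2 / (N i).card * ∑ j ∈ N i, pairWeight (d i) (d j) ^ 2
        = n * ((d i : ℝ) ^ 2 / (N i).card) * ∑ j ∈ N i, pairWeight (d i) (d j) ^ 2 := by ring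
      _ ≤ n * ((1 + e) ^ 2 * (N i).card) * (4 * ((1 + e) * √(pairCount N))) := by gcongr
      _ = (1 + e) ^ 3 * (4 * n * √(pairCount N) * (N i).card) := by ring
      _ ≤ 2 * (4 * n * √(pairCount N) * (N i).card) := by gcongr
      _ = _ := by ring
  refine (sum_le_sum fun i _ => hterm i).trans_eq ?_
  rw [← mul_sum, ← Nat.cast_sum, ← pairCount]
  ring

/-- The random choices of the samples: an `L × K` array of pairs of a row index and an order. -/
abbrev SampleSeed (n L K : ℕ) : Type := Fin L → Fin K → Fin n × Equiv.Perm (Fin n)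

/-- The median of means of the sample values, shifted by `b`. -/
noncomputable def estimatorTree {ℓ L κ L' K : ℕ} (e b : ℝ) (r : SizeSeed n ℓ L κ)
    (s : SampleSeed n L' K) : QueryTree (HitQuery n) ℝ :=
  (QueryTree.sequence fun l => QueryTree.sequence fun k => sampleTree e r (s l k)).bind fun z =>
    .done (medianOfMeans z - b)

lemma length_asked_estimatorTree_le {ℓ L κ L' K : ℕ} (o : HitQuery n → Bool) (e b : ℝ)
    (r : SizeSeed n ℓ L κ) (s : SampleSeed n L' K) :
    ((estimatorTree e b r s).asked o).length ≤ L' * (K * (2 * ((ℓ + 1) * (L * κ)) + ℓ)) := by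
  simp only [estimatorTree, QueryTree.asked_bind, QueryTree.asked, List.append_nil]
  exact QueryTree.length_asked_sequence_le _ _ fun l =>
    QueryTree.length_asked_sequence_le _ _ fun k => length_asked_sampleTree_le o e r _

lemma unifProb_estimatorTree_le {N : Fin n → Finset (Fin n)}
    (hN : ∀ i j, j ∈ N i ↔ i ∈ N j) (hn : 0 < n) {ℓ L κ : ℕ} (hℓ : n ≤ 2 ^ ℓ) {e θ T : ℝ} (b : ℝ)
    (he : 0 ≤ e) (he4 : e ≤ 1 / 4) (hθ : 0 < θ) (hT : 0 < T) {K : ℕ}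
    (hK : 128 * n ≤ K * θ ^ 2 * √T) {r : SizeSeed n ℓ L κ}
    (hr : ApproxSizes N e (sizeEstimate N e r)) (L' : ℕ) :
    unifProb (fun s : SampleSeed n L' K => e * pairCount N + θ * (pairCount N + T) ≤
      |(estimatorTree e b r s).eval (hits N) + b - pairCount N|) ≤ (1 / 2) ^ L' := by
  have : Nonempty (Fin n) := ⟨⟨0, hn⟩⟩
  have hK0 : 0 < K := by
    rcases Nat.eq_zero_or_pos K with h | h
    · have : (0 : ℝ) < n := by exact_mod_cast hn
      rw [h] at hK; norm_num at hK; linarith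
    · exact h
  set D : ℝ := ((pairCount N : ℕ) : ℝ) with hD
  have hD0 : 0 ≤ D := Nat.cast_nonneg _
  have hsize : 16 * (8 * n * (D * √D)) ≤ K * (θ * (D + T)) ^ 2 := by
    -- `(D + T) ^ 2 ≥ D ^ (3 / 2) * T ^ (1 / 2)`
    have h1 : √D * √T ≤ D + T := by
      nlinarith [Real.sq_sqrt hD0, Real.sq_sqrt hT.le, sq_nonneg (√D - √T),
        mul_nonneg (Real.sqrt_nonneg D) (Real.sqrt_nonneg T)]
    have h2 : D * √D * √T ≤ (D + T) ^ 2 := by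
      calc D * √D * √T = D * (√D * √T) := by ring
        _ ≤ (D + T) * (D + T) := by gcongr; linarith
        _ = _ := by ring
    have hsT : 0 < √T := Real.sqrt_pos.2 hT
    calc 16 * (8 * n * (D * √D)) = 128 * n * (D * √D) := by ring
      _ ≤ K * θ ^ 2 * √T * (D * √D) := by gcongr
      _ = K * θ ^ 2 * (D * √D * √T) := by ring
      _ ≤ K * θ ^ 2 * (D + T) ^ 2 := by gcongr
      _ = _ := by ring
  refine le_trans (unifProb_mono fun s hs => ?_)
    (unifProb_medianOfMeans_ge_le (fun s => (sampleTree e r s).eval (hits N))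
      (expect_sampleTree_sq_le hn hℓ he he4 hr) (a := θ * (D + T)) (by positivity) hsize hK0 L')
  have hmean := abs_expect_sampleTree_sub_le hN hn hℓ he hr
  have heval : (estimatorTree e b r s).eval (hits N) + b =
      medianOfMeans fun l k => (sampleTree e r (s l k)).eval (hits N) := by
    simp only [estimatorTree, QueryTree.eval_bind, QueryTree.eval_sequence, QueryTree.eval]
    ring
  rw [heval] at hs
  have htri := abs_sub_le (medianOfMeans fun l k => (sampleTree e r (s l k)).eval (hits N))
    (𝔼 s, (sampleTree e r s).eval (hits N)) D
  linarith

end EdgeEstimator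

/-! ### Parameters and the algorithm -/

section Algorithm

lemma toMeasure_map_uniformOfFintype {Ω : Type*} [Fintype Ω] [Nonempty Ω] (g : Ω → ℝ) {S : Set ℝ}
    (hS : MeasurableSet S) :
    ((PMF.uniformOfFintype Ω).map g).toMeasure S = ENNReal.ofReal (unifProb fun ω => g ω ∈ S) := by
  classical
  rw [PMF.toMeasure_apply_eq_toOuterMeasure_apply _ hS, PMF.toOuterMeasure_map_apply,
    PMF.toOuterMeasure_uniformOfFintype_apply, unifProb, Fintype.expect_eq_sum_div_card,
    sum_boole, ENNReal.ofReal_div_of_pos (by exact_mod_cast Fintype.card_pos),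
    ENNReal.ofReal_natCast, ENNReal.ofReal_natCast]
  congr 2
  rw [← Fintype.card_subtype]
  exact Fintype.card_congr (Equiv.refl _)

lemma matrixDist_eq_pairCount {n : ℕ} (A B : Matrix (Fin n) (Fin n) ℝ) :
    matrixDist A B = pairCount (diffRow A B) := by
  classical
  simp only [matrixDist, pairCount, diffRow, card_filter]
  rw [← univ_product_univ, sum_product]

lemma mem_diffRow_comm {n : ℕ} {A B : Matrix (Fin n) (Fin n) ℝ} (hA : A.IsSymm) (hB : B.IsSymm)
    (i j : Fin n) : j ∈ diffRow A B i ↔ i ∈ diffRow A B j := by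
  simp only [diffRow, mem_filter, mem_univ, true_and]
  rw [hA.apply, hB.apply]

/-- The integer `ℓ` in which all parameters are expressed; both `log n` and `1 / ε` are at
most `ℓ`. -/
noncomputable def logScale (n : ℕ) (ε : ℝ) : ℕ := ⌈(1 + Real.log n) / ε⌉₊

/-- The number of samples in each average: with relative accuracy `θ = 1 / (3200 ℓ)` it is
`128 n / (θ² √T)`, rounded up. -/
noncomputable def sampleReps (n ℓ : ℕ) (T : ℝ) : ℕ := ⌈128 * (n : ℝ) * (3200 * ℓ) ^ 2 / √T⌉₊

/-- All random choices of the algorithm: the sequences for the size estimates, the samples, and the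
test vectors by which hitting queries are simulated. With `x = 2 ^ (-ℓ)`, the numbers of repetitions
make each of the three stages fail with probability at most `x ^ (c + 2)`: there are at most
`n (ℓ + 1) ≤ x ^ (-2)` size statistics, and at most `x ^ (-(2 c + 73))` hitting queries. The length
`16 (1000 ℓ)²` of the averages gives the accuracy `e / 50` for `e = 1 / (20 ℓ)`. -/
abbrev FullSeed (c n ℓ : ℕ) (T : ℝ) : Type :=
  SizeSeed n ℓ ((c + 4) * ℓ) (16 * (1000 * ℓ) ^ 2) ×
    SampleSeed n ((c + 4) * ℓ) (sampleReps n ℓ T) × (Fin ((3 * c + 75) * ℓ) → Fin n → Bool)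

/-- The tree of hitting queries for given random choices. The median of means is lowered by
`ε T / 3200`, so that the additive error only affects the lower bound. -/
noncomputable def distTree {c n ℓ : ℕ} {T : ℝ} (ε : ℝ) (ω : FullSeed c n ℓ T) :
    QueryTree (HitQuery n) ℝ :=
  estimatorTree (1 / (20 * ℓ)) (ε * T / 3200) ω.1 ω.2.1

/-- The inner product algorithm for given random choices. -/
noncomputable def distIP {c n ℓ : ℕ} {T : ℝ} (ε : ℝ) (ω : FullSeed c n ℓ T) : IPAlgorithm n :=
  (distTree ε ω).toIP (List.ofFn ω.2.2)

open Classical in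
/-- The randomized algorithm. If `ε T ≥ 1600 n²`, then `0` is a correct output. -/
noncomputable def distAlgorithm (c n : ℕ) (ε T : ℝ) : RandomizedIPAlgorithm n :=
  if h : 0 < n ∧ ε * T < 1600 * (n : ℝ) ^ 2 then
    have : Nonempty (Fin n) := ⟨⟨0, h.1⟩⟩
    (PMF.uniformOfFintype (FullSeed c n (logScale n ε) T)).map (distIP ε)
  else PMF.pure (.output 0)

section Bounds

variable {n : ℕ} {ε T : ℝ}

lemma two_le_ratio (n : ℕ) (hε : 0 < ε) (hε2 : ε < 1 / 2) :
    2 ≤ (1 + Real.log n) / ε ∧ 1 / ε ≤ (1 + Real.log n) / ε ∧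
      2 * Real.log n ≤ (1 + Real.log n) / ε := by
  have hlog : 0 ≤ Real.log n := Real.log_natCast_nonneg n
  refine ⟨?_, ?_, ?_⟩
  · rw [le_div_iff₀ hε]; nlinarith
  · gcongr; linarith
  · rw [le_div_iff₀ hε]; nlinarith

lemma le_logScale (n : ℕ) (ε : ℝ) : (1 + Real.log n) / ε ≤ logScale n ε := Nat.le_ceil _

lemma logScale_le (n : ℕ) (hε : 0 < ε) (hε2 : ε < 1 / 2) :
    (logScale n ε : ℝ) ≤ 2 * ((1 + Real.log n) / ε) := by
  have h := (two_le_ratio n hε hε2).1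
  have := Nat.ceil_lt_add_one (a := (1 + Real.log n) / ε) (by linarith)
  unfold logScale
  linarith

lemma one_le_logScale (n : ℕ) (hε : 0 < ε) (hε2 : ε < 1 / 2) : 1 ≤ logScale n ε := by
  have h : (1 : ℝ) ≤ logScale n ε := by
    linarith [le_logScale n ε, (two_le_ratio n hε hε2).1]
  exact_mod_cast h

lemma le_two_pow_logScale (hn : 0 < n) (hε : 0 < ε) (hε2 : ε < 1 / 2) :
    n ≤ 2 ^ logScale n ε := by
  have hnR : (0 : ℝ) < n := by exact_mod_cast hn
  have h : Real.log n ≤ Real.log (2 ^ logScale n ε) := by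
    rw [Real.log_pow]
    have h1 := (two_le_ratio n hε hε2).2.2
    have h2 := le_logScale n ε
    have h3 := Real.log_two_gt_d9
    nlinarith [(Nat.cast_nonneg (logScale n ε) : (0 : ℝ) ≤ logScale n ε)]
  have := (Real.log_le_log_iff hnR (by positivity)).1 h
  exact_mod_cast this

lemma one_div_le_logScale (n : ℕ) (hε : 0 < ε) (hε2 : ε < 1 / 2) :
    1 / (logScale n ε : ℝ) ≤ ε := by
  have h1 := (two_le_ratio n hε hε2).2.1.trans (le_logScale n ε)
  rw [div_le_iff₀ hε] at h1
  have h0 : (0 : ℝ) < logScale n ε := by exact_mod_cast one_le_logScale n hε hε2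
  rw [div_le_iff₀ h0]
  linarith

lemma sampleReps_le (hn : 0 < n) (hε : 0 < ε) (hε2 : ε < 1 / 2) (hT : 0 < T)
    (h : ε * T < 1600 * (n : ℝ) ^ 2) :
    (sampleReps n (logScale n ε) T : ℝ) ≤ 2 ^ 31 * (logScale n ε : ℝ) ^ 2 * (n / √T) := by
  set ℓ := logScale n ε with hℓ
  have hnR : (0 : ℝ) < n := by exact_mod_cast hn
  have hsT : 0 < √T := Real.sqrt_pos.2 hT
  have hℓ1 : (1 : ℝ) ≤ ℓ := by exact_mod_cast one_le_logScale n hε hε2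
  have hinv := one_div_le_logScale n hε hε2
  rw [← hℓ, div_le_iff₀ (by linarith)] at hinv
  -- The rounding is absorbed, because `n / √T` is not much smaller than `1`.
  have hone : 1 ≤ 40 * (ℓ : ℝ) * (n / √T) := by
    rw [mul_div_assoc', le_div_iff₀ hsT, one_mul]
    refine Real.sqrt_le_iff.2 ⟨by positivity, ?_⟩
    calc T ≤ ε * ℓ * T := by nlinarith
      _ = ε * T * ℓ := by ring
      _ ≤ 1600 * (n : ℝ) ^ 2 * ℓ := by gcongr
      _ ≤ 1600 * (n : ℝ) ^ 2 * (ℓ * ℓ) := by gcongr; nlinarith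
      _ = _ := by ring
  have hceil := (Nat.ceil_lt_add_one
    (a := 128 * (n : ℝ) * (3200 * ℓ) ^ 2 / √T) (by positivity)).le
  have hx : 0 ≤ (n : ℝ) / √T := by positivity
  calc (sampleReps n ℓ T : ℝ) ≤ 128 * (n : ℝ) * (3200 * ℓ) ^ 2 / √T + 1 := hceil
    _ = 1310720000 * ((ℓ : ℝ) ^ 2 * (n / √T)) + 1 := by ring
    _ ≤ 1310720000 * ((ℓ : ℝ) ^ 2 * (n / √T)) + 40 * (ℓ : ℝ) * (n / √T) := by gcongr
    _ ≤ 1310720000 * ((ℓ : ℝ) ^ 2 * (n / √T)) + 40 * (ℓ : ℝ) ^ 2 * (n / √T) := by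
        gcongr; nlinarith
    _ ≤ 2 ^ 31 * (ℓ : ℝ) ^ 2 * (n / √T) := by nlinarith [mul_nonneg (sq_nonneg (ℓ : ℝ)) hx]

lemma length_asked_distTree_le (c : ℕ) (hn : 0 < n) (hε : 0 < ε) (hε2 : ε < 1 / 2) (hT : 0 < T)
    (h : ε * T < 1600 * (n : ℝ) ^ 2) (o : HitQuery n → Bool) {ℓ : ℕ} (hℓ : ℓ = logScale n ε)
    (ω : FullSeed c n ℓ T) :
    (((distTree ε ω).asked o).length : ℝ) ≤
      2 ^ 57 * (c + 4 : ℝ) ^ 2 * (ℓ : ℝ) ^ 7 * (n / √T) := by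
  have hlen : ((distTree ε ω).asked o).length ≤ _ :=
    length_asked_estimatorTree_le o (1 / (20 * (ℓ : ℝ))) (ε * T / 3200) ω.1 ω.2.1
  have hK := sampleReps_le hn hε hε2 hT h
  have hℓ1 : (1 : ℝ) ≤ logScale n ε := by exact_mod_cast one_le_logScale n hε hε2
  rw [← hℓ] at hK hℓ1
  set K := sampleReps n ℓ T with hKdef
  have hlenR : (((distTree ε ω).asked o).length : ℝ) ≤ ((c + 4) * ℓ) *
      (K * (2 * ((ℓ + 1) * (((c + 4) * ℓ) * (16 * (1000 * ℓ) ^ 2))) + ℓ)) := by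
    exact_mod_cast hlen
  have hx : 0 ≤ (n : ℝ) / √T := by positivity
  have hper : 2 * (((ℓ : ℝ) + 1) * (((c + 4) * ℓ) * (16 * (1000 * ℓ) ^ 2))) + ℓ ≤
      2 ^ 26 * (c + 4) * (ℓ : ℝ) ^ 4 := by
    have h1 : (ℓ : ℝ) + 1 ≤ 2 * ℓ := by linarith
    have h2 : (ℓ : ℝ) ≤ (c + 4) * (ℓ : ℝ) ^ 4 := by
      calc (ℓ : ℝ) = 1 * (ℓ : ℝ) ^ 1 := by ring
        _ ≤ (c + 4) * (ℓ : ℝ) ^ 4 := by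
          gcongr
          · linarith [(Nat.cast_nonneg c : (0 : ℝ) ≤ c)]
          · norm_num
    calc 2 * (((ℓ : ℝ) + 1) * (((c + 4) * ℓ) * (16 * (1000 * ℓ) ^ 2))) + ℓ
        ≤ 2 * ((2 * ℓ) * (((c + 4) * ℓ) * (16 * (1000 * ℓ) ^ 2))) + (c + 4) * (ℓ : ℝ) ^ 4 := by
          gcongr
      _ = 64000001 * ((c + 4) * (ℓ : ℝ) ^ 4) := by ring
      _ ≤ 2 ^ 26 * ((c + 4) * (ℓ : ℝ) ^ 4) := by gcongr; norm_num
      _ = _ := by ring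
  calc (((distTree ε ω).asked o).length : ℝ)
      ≤ ((c + 4) * ℓ) * (K * (2 * ((ℓ + 1) * (((c + 4) * ℓ) * (16 * (1000 * ℓ) ^ 2))) + ℓ)) := hlenR
    _ ≤ ((c + 4) * ℓ) * ((2 ^ 31 * (ℓ : ℝ) ^ 2 * (n / √T)) *
          (2 ^ 26 * (c + 4) * (ℓ : ℝ) ^ 4)) := by gcongr
    _ = _ := by ring

lemma length_asked_distTree_le_two_pow (c : ℕ) (hn : 0 < n) (hε : 0 < ε) (hε2 : ε < 1 / 2)
    (hT : 1 ≤ T) (h : ε * T < 1600 * (n : ℝ) ^ 2) (o : HitQuery n → Bool) {ℓ : ℕ}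
    (hℓ : ℓ = logScale n ε) (ω : FullSeed c n ℓ T) :
    (((distTree ε ω).asked o).length : ℝ) ≤ 2 ^ ((2 * c + 73) * ℓ) := by
  refine (length_asked_distTree_le c hn hε hε2 (by linarith) h o hℓ ω).trans ?_
  have hℓ1 : 1 ≤ logScale n ε := one_le_logScale n hε hε2
  have hn2 : (n : ℝ) ≤ 2 ^ logScale n ε := by exact_mod_cast le_two_pow_logScale hn hε hε2
  rw [← hℓ] at hℓ1 hn2
  have hx : (n : ℝ) / √T ≤ 2 ^ ℓ :=
    (div_le_self (Nat.cast_nonneg n) (Real.one_le_sqrt.2 hT)).trans hn2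
  have hℓ2 : (ℓ : ℝ) ≤ 2 ^ ℓ := by exact_mod_cast ℓ.lt_two_pow_self.le
  have hc2 : (c + 4 : ℝ) ≤ 2 ^ (c + 4) := by exact_mod_cast (c + 4).lt_two_pow_self.le
  calc 2 ^ 57 * (c + 4 : ℝ) ^ 2 * (ℓ : ℝ) ^ 7 * (n / √T)
      ≤ 2 ^ 57 * (2 ^ (c + 4)) ^ 2 * (2 ^ ℓ) ^ 7 * 2 ^ ℓ := by gcongr
    _ = 2 ^ (57 + (c + 4) * 2 + ℓ * 7 + ℓ) := by rw [← pow_mul, ← pow_mul]; ring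
    _ ≤ 2 ^ ((2 * c + 73) * ℓ) := pow_le_pow_right₀ (by norm_num) (by nlinarith)

end Bounds

lemma numQueries_distIP_le {n c : ℕ} {ε T : ℝ} (hn : 0 < n) (hε : 0 < ε) (hε2 : ε < 1 / 2)
    (hT : 0 < T) (h : ε * T < 1600 * (n : ℝ) ^ 2) (A B : Matrix (Fin n) (Fin n) ℝ)
    {ℓ : ℕ} (hℓ : ℓ = logScale n ε) (ω : FullSeed c n ℓ T) :
    ((distIP ε ω).numQueries A B : ℝ) ≤ 2 ^ 66 * (3 * c + 75) * (c + 4) ^ 2 *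
      ((1 + Real.log n) / ε) ^ 8 * (n / √T) := by
  have h1 := QueryTree.numQueries_toIP_le A B (List.ofFn ω.2.2) (distTree ε ω)
  have h2 := length_asked_distTree_le c hn hε hε2 hT h (testHit A B (List.ofFn ω.2.2)) hℓ ω
  have h3 := logScale_le n hε hε2
  rw [← hℓ] at h3
  set t := ((distTree ε ω).asked (testHit A B (List.ofFn ω.2.2))).length with ht
  have h1R : ((distIP ε ω).numQueries A B : ℝ) ≤ 2 * ((3 * c + 75) * ℓ) * t := by
    rw [List.length_ofFn] at h1
    exact_mod_cast h1
  have hx : 0 ≤ (n : ℝ) / √T := by positivity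
  calc ((distIP ε ω).numQueries A B : ℝ) ≤ 2 * ((3 * c + 75) * ℓ) * t := h1R
    _ ≤ 2 * ((3 * c + 75) * ℓ) * (2 ^ 57 * (c + 4 : ℝ) ^ 2 * (ℓ : ℝ) ^ 7 * (n / √T)) := by gcongr
    _ = 2 ^ 58 * (3 * c + 75) * (c + 4) ^ 2 * (ℓ : ℝ) ^ 8 * (n / √T) := by ring
    _ ≤ 2 ^ 58 * (3 * c + 75) * (c + 4) ^ 2 * (2 * ((1 + Real.log n) / ε)) ^ 8 * (n / √T) := by
        gcongr
    _ = _ := by ring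

lemma unifProb_run_distIP_notMem_le {n c : ℕ} {ε T : ℝ} (hn : 0 < n) (hε : 0 < ε)
    (hε2 : ε < 1 / 2) (hT : 1 ≤ T) (h : ε * T < 1600 * (n : ℝ) ^ 2)
    {A B : Matrix (Fin n) (Fin n) ℝ} (hA : A.IsSymm) (hB : B.IsSymm) :
    unifProb (fun ω : FullSeed c n (logScale n ε) T => ¬ (distIP ε ω).run A B ∈
      Set.Icc ((1 - ε / 10) * (matrixDist A B : ℝ) - ε / 1600 * T)
        ((1 + ε / 10) * (matrixDist A B : ℝ))) ≤ 1 / (n : ℝ) ^ c := by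
  have hT0 : 0 < T := by linarith
  have hℓ1 : 1 ≤ logScale n ε := one_le_logScale n hε hε2
  have hn2 : n ≤ 2 ^ logScale n ε := le_two_pow_logScale hn hε hε2
  have hinv := one_div_le_logScale n hε hε2
  have hq := length_asked_distTree_le_two_pow c hn hε hε2 hT h (hits (diffRow A B))
    (ℓ := logScale n ε) rfl
  rw [matrixDist_eq_pairCount]
  set N := diffRow A B with hN
  have hsymm : ∀ i j, j ∈ N i ↔ i ∈ N j := mem_diffRow_comm hA hB
  set ℓ := logScale n ε with hℓ
  have hℓR : (1 : ℝ) ≤ ℓ := by exact_mod_cast hℓ1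
  set e : ℝ := 1 / (20 * ℓ) with he
  set θ : ℝ := 1 / (3200 * ℓ) with hθ
  have he_eq : e = 1 / ℓ / 20 := by rw [he, div_div, mul_comm]
  have hθ_eq : θ = 1 / ℓ / 3200 := by rw [hθ, div_div, mul_comm]
  have heε : e ≤ ε / 20 := by rw [he_eq]; linarith
  have hθε : θ ≤ ε / 3200 := by rw [hθ_eq]; linarith
  have he0 : 0 < e := by positivity
  have hθ0 : 0 < θ := by positivity
  set D : ℝ := ((pairCount N : ℕ) : ℝ) with hD
  have hD0 : 0 ≤ D := Nat.cast_nonneg _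
  have hK : 128 * (n : ℝ) ≤ sampleReps n ℓ T * θ ^ 2 * √T := by
    have hsT : 0 < √T := Real.sqrt_pos.2 hT0
    have := Nat.le_ceil (128 * (n : ℝ) * (3200 * ℓ) ^ 2 / √T)
    rw [div_le_iff₀ hsT] at this
    have hθ1 : (3200 * (ℓ : ℝ)) ^ 2 * θ ^ 2 = 1 := by
      rw [hθ]; field_simp
    calc 128 * (n : ℝ) = 128 * (n : ℝ) * (3200 * ℓ) ^ 2 * θ ^ 2 := by
          rw [mul_assoc, hθ1, mul_one]
      _ ≤ (sampleReps n ℓ T * √T) * θ ^ 2 :=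
          mul_le_mul_of_nonneg_right this (by positivity)
      _ = _ := by ring
  have hκ : (16 : ℝ) ≤ ((16 * (1000 * ℓ) ^ 2 : ℕ) : ℝ) * (e / 50) ^ 2 := by
    refine le_of_eq ?_
    rw [he]; push_cast; field_simp; norm_num
  have hfail1 := unifProb_not_approxSizes_le N hn (L := (c + 4) * ℓ) hn2 he0 (by linarith) hκ
  have key := unifProb_prod_le (q := fun ω : FullSeed c n ℓ T => ¬ (distIP ε ω).run A B ∈
      Set.Icc ((1 - ε / 10) * D - ε / 1600 * T) ((1 + ε / 10) * D))
    (θ := (1 / 2) ^ ((c + 4) * ℓ) + 2 ^ ((2 * c + 73) * ℓ) * (1 / 2) ^ ((3 * c + 75) * ℓ))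
    (by positivity) hfail1 fun r hr => by
      rw [not_not] at hr
      refine unifProb_prod_le (by positivity)
        (unifProb_estimatorTree_le hsymm hn hn2 (ε * T / 3200) he0.le (by linarith) hθ0 hT0 hK hr
          ((c + 4) * ℓ)) fun s hs => ?_
      refine le_trans (unifProb_mono fun V hV => ?_)
        ((unifProb_run_toIP_ne_le A B (estimatorTree e (ε * T / 3200) r s)
          ((3 * c + 75) * ℓ)).trans ?_)
      · -- A correctly simulated run of a good sample has its output in the interval.
        intro hrun
        refine hV ?_
        change ((estimatorTree e (ε * T / 3200) r s).toIP (List.ofFn V)).run A B ∈ _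
        rw [hrun]
        rw [not_le, abs_lt] at hs
        have h1 : e * D ≤ ε / 20 * D := by gcongr
        have h2 : θ * (D + T) ≤ ε / 3200 * (D + T) := by gcongr
        have h3 : 0 ≤ ε * D := by positivity
        constructor
        · linarith [hs.1]
        · linarith [hs.2]
      · gcongr
        -- The tree does not depend on the test vectors, so any may be inserted.
        exact hq (r, s, fun _ _ => false)
  refine key.trans ?_
  have hn2R : (n : ℝ) ≤ 2 ^ ℓ := by exact_mod_cast hn2
  have hℓ2 : (ℓ + 1 : ℝ) ≤ 2 ^ ℓ := by exact_mod_cast ℓ.lt_two_pow_self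
  have hnc : (n : ℝ) ^ c ≤ 2 ^ (c * ℓ) := by
    rw [mul_comm, pow_mul]; gcongr
  set x : ℝ := (1 / 2) ^ ℓ with hx
  have hx0 : 0 < x := by positivity
  have hx1 : x ≤ 1 / 2 := by
    calc x ≤ (1 / 2) ^ 1 := pow_le_pow_of_le_one (by norm_num) (by norm_num) hℓ1
      _ = 1 / 2 := by norm_num
  have hx2 : (2 : ℝ) ^ ℓ * x = 1 := by rw [hx, ← mul_pow]; norm_num
  have hpow : ∀ m : ℕ, (1 / 2 : ℝ) ^ (m * ℓ) = x ^ m := fun m => by rw [mul_comm, pow_mul]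
  have hA1 : (n * (ℓ + 1)) * (1 / 2 : ℝ) ^ ((c + 4) * ℓ) ≤ x ^ (c + 2) := by
    rw [hpow]
    calc (n * (ℓ + 1)) * x ^ (c + 4) ≤ (2 ^ ℓ * 2 ^ ℓ) * x ^ (c + 4) := by gcongr
      _ = (2 ^ ℓ * x) ^ 2 * x ^ (c + 2) := by ring
      _ = x ^ (c + 2) := by rw [hx2]; ring
  have hA2 : (1 / 2 : ℝ) ^ ((c + 4) * ℓ) ≤ x ^ (c + 2) := by
    rw [hpow]; exact pow_le_pow_of_le_one hx0.le (by linarith) (by omega)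
  have hA3 : (2 : ℝ) ^ ((2 * c + 73) * ℓ) * (1 / 2) ^ ((3 * c + 75) * ℓ) = x ^ (c + 2) := by
    rw [hpow, mul_comm (2 * c + 73), pow_mul]
    calc ((2 : ℝ) ^ ℓ) ^ (2 * c + 73) * x ^ (3 * c + 75)
        = (2 ^ ℓ * x) ^ (2 * c + 73) * x ^ (c + 2) := by ring
      _ = x ^ (c + 2) := by rw [hx2]; ring
  have hxc : x ^ c ≤ 1 / (n : ℝ) ^ c := by
    rw [← hpow, one_div, inv_pow, one_div]
    have : (0 : ℝ) < n := by exact_mod_cast hn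
    gcongr
  have h4 : x ^ (c + 2) ≤ x ^ c / 4 := by
    rw [pow_add]
    have : x ^ 2 ≤ 1 / 4 := by nlinarith
    nlinarith [pow_pos hx0 c]
  rw [hA3]
  linarith [pow_pos hx0 c]

end Algorithm

theorem mainTheorem2 (c : ℕ) :
    ∃ (C₁ C₂ : ℝ) (k₁ k₂ : ℕ)
      (distSymmMatrixGuess : (n : ℕ) → (ε T : ℝ) → RandomizedIPAlgorithm n),
      0 < C₁ ∧ 0 < C₂ ∧
      ∀ (n : ℕ) (ε T : ℝ), 0 < ε → ε < 1 / 2 →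
        C₁ * ((1 + Real.log (n : ℝ)) / ε) ^ k₁ ≤ T →
        ∀ A B : Matrix (Fin n) (Fin n) ℝ, A.IsSymm → B.IsSymm →
          (∀ a ∈ (distSymmMatrixGuess n ε T).support,
            (a.numQueries A B : ℝ) ≤
              C₂ * ((1 + Real.log (n : ℝ)) / ε) ^ k₂ * ((n : ℝ) / Real.sqrt T)) ∧
          ENNReal.ofReal (1 - 1 / (n : ℝ) ^ c) ≤
            RandomizedIPAlgorithm.outputLaw (distSymmMatrixGuess n ε T) A B
              (Set.Icc
                ((1 - ε / 10) * (matrixDist A B : ℝ) - ε / 1600 * T)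
                ((1 + ε / 10) * (matrixDist A B : ℝ))) := by
  -- The bounds hold for all `T ≥ 1`, so the lower bound on `T` needs no logarithmic factor.
  refine ⟨1, 2 ^ 66 * (3 * c + 75) * (c + 4) ^ 2, 0, 8, distAlgorithm c, one_pos, by positivity,
    fun n ε T hε hε2 hT A B hA hB => ?_⟩
  have hT1 : 1 ≤ T := by simpa using hT
  by_cases h : 0 < n ∧ ε * T < 1600 * (n : ℝ) ^ 2
  · have : Nonempty (Fin n) := ⟨⟨0, h.1⟩⟩
    rw [distAlgorithm, dif_pos h]
    constructor
    · intro a ha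
      rw [PMF.mem_support_map_iff] at ha
      obtain ⟨ω, -, rfl⟩ := ha
      exact numQueries_distIP_le h.1 hε hε2 (by linarith) h.2 A B rfl ω
    · rw [RandomizedIPAlgorithm.outputLaw, PMF.map_comp,
        toMeasure_map_uniformOfFintype _ measurableSet_Icc]
      refine ENNReal.ofReal_le_ofReal ?_
      have hbad := unifProb_run_distIP_notMem_le (c := c) h.1 hε hε2 hT1 h.2 hA hB
      rw [unifProb_not] at hbad
      simp only [Function.comp_apply]
      linarith
  · rw [distAlgorithm, dif_neg h]
    constructor
    · intro a ha
      rw [PMF.support_pure, Set.mem_singleton_iff] at ha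
      have hlog : 0 ≤ Real.log n := Real.log_natCast_nonneg n
      rw [ha]
      simp only [IPAlgorithm.numQueries, Nat.cast_zero]
      positivity
    · rw [RandomizedIPAlgorithm.outputLaw, PMF.pure_map,
        PMF.toMeasure_pure, MeasureTheory.Measure.dirac_apply' _ measurableSet_Icc]
      have hD : (matrixDist A B : ℝ) ≤ (n : ℝ) ^ 2 := by
        have : matrixDist A B ≤ n ^ 2 := by
          rw [sq]
          simpa [matrixDist] using card_filter_le (univ : Finset (Fin n × Fin n))
            fun p => A p.1 p.2 ≠ B p.1 p.2
        exact_mod_cast this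
      have hle : 1600 * (n : ℝ) ^ 2 ≤ ε * T := by
        rcases Nat.eq_zero_or_pos n with hn | hn
        · subst hn; norm_num; nlinarith
        · by_contra hcon
          exact h ⟨hn, not_le.1 hcon⟩
      have hD0 : (0 : ℝ) ≤ matrixDist A B := Nat.cast_nonneg _
      have hmem : IPAlgorithm.run A B (.output 0) ∈ Set.Icc
          ((1 - ε / 10) * (matrixDist A B : ℝ) - ε / 1600 * T)
          ((1 + ε / 10) * (matrixDist A B : ℝ)) := by
        refine ⟨?_, by simp only [IPAlgorithm.run]; positivity⟩
        simp only [IPAlgorithm.run]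
        nlinarith [mul_nonneg hε.le hD0]
      rw [Set.indicator_of_mem hmem, Pi.one_apply]
      refine ENNReal.ofReal_le_one.2 ?_
      have : (0 : ℝ) ≤ 1 / (n : ℝ) ^ c := by positivity
      linarith
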